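/- **Corollary 4.2.** *Setting.* For a finite set $S\subseteq[d]$ and $b\in\{0,1\}$ let $f_{S,b}:\{0,1\}^d\to\{0,1\}$, $f_{S,b}(x)=b+\sum_{i\in S}x_i \pmod 2$, and let $\mathsf{AffParity}_d=\{f_{S,b}\}$ be the class of affine parities. The *decision tree complexity* of a distribution $\mathcal D$ on $\{0,1\}^d$ is the least integer $k\ge 1$ such that its probability mass function is computed by a decision tree of depth at most $k$ (inner nodes query coordinates, leaves carry real numbers). $\mathcal D$ is *monotone* if $\mathcal D(y)\le\mathcal D(x)$ whenever $y\le x$ coordinatewise. A *conditional sampling oracle* for $\mathcal D$ receives a partial assignment of the coordinates and, if the subcube of the points consistent with it has positive mass, returns a fresh point drawn from $\mathcal D$ conditioned on this subcube (on subcubes of mass zero its answers may have any distribution). A learner is a program $P$ with a second program $E$ that evaluates hypotheses: on the parameters $(d,\ell,\lceil 1/\alpha\rceil,\lceil 1/\rho\rceil,\lceil 1/\beta\rceil)$, labelled examples $(x,f^\star(x))$ with independent $x\sim\mathcal D$, a string $r$ of fair random bits, and the answers to its oracle calls, if any, $P$ outputs a description $o$, and $E$ computes from $o$ and a point $x$ the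 bit $h_o(x)$. Programs are finite, fixed for all values of the parameters, of the unknown distribution and of the unknown target; time is the number of steps in a machine model polynomially equivalent to Turing machines (programs over binary trees with unit-cost pairing, projections, test for nil, and oracle calls). For given parameters, such a learner is a *$\rho$-replicable $(\alpha,\beta)$-PAC learner for $\mathsf{AffParity}_d$ under $\mathcal D$* if for every $f^\star\in\mathsf{AffParity}_d$ - with probability at least $1-\beta$ over the examples, the oracle's answers and $r$, its output $o$ satisfies $\Pr_{x\sim\mathcal D}[h_o(x)\ne f^\star(x)]\le\alpha$; and - two executions with the same $r$, but independent examples and independent oracle answers, have different outputs with probability at most $\rho$. *Claim.* There are a polynomial $q$ in four variables with coefficients in $\mathbb N$, a constant $c\in\mathbb N$, and polynomials $p_R,p_T$ in one variable with coefficients in $\mathbb N$ such that, with $$M=M(d,\ell,\alpha,\rho,\beta)=q\big(d,\lceil 1/\alpha\rceil,\lceil 1/\rho\rceil,\lceil 1/\beta\rceil\big)^{c\,\ell},$$ the following hold. (a) There is a learner $(P,E)$ such that, for all integers $d\ge 0$, $\ell\ge 1$ and all real $\alpha,\rho\in(0,1)$, $\beta\in(0,\rho/3)$, it uses $M$ labelled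 examples, no conditional samples, and $p_R(M)$ random bits, $P$ and $E$ halt within $p_T(M)$ steps in the worst case, and it is a $\rho$-replicable $(\alpha,\beta)$-PAC learner for $\mathsf{AffParity}_d$ under every monotone distribution $\mathcal D$ on $\{0,1\}^d$ of decision tree complexity at most $\ell$. (b) There is a learner $(P,E)$ such that, for all such $d,\ell,\alpha,\rho,\beta$, it uses $M$ labelled examples, at most $M$ (unlabelled) conditional samples, and $p_R(M)$ random bits, $P$ and $E$ halt within $p_T(M)$ steps in the worst case, and it is a $\rho$-replicable $(\alpha,\beta)$-PAC learner for $\mathsf{AffParity}_d$ under every distribution $\mathcal D$ on $\{0,1\}^d$ of decision tree complexity at most $\ell$, for every conditional sampling oracle for $\mathcal D$. -/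

import Mathlib

open MeasureTheory ProbabilityTheory

namespace ReplicableParity

noncomputable section

/-! ### The Boolean cube, affine parities and decision tree distributions -/

/-- The Boolean cube `{0,1}^d`, ordered pointwise (`false ≤ true`). -/
abbrev Point (d : ℕ) : Type := Fin d → Bool

/-- The affine parity `x ↦ b + ∑ i ∈ S, x i` with arithmetic modulo 2. -/
def affParity {d : ℕ} (S : Finset (Fin d)) (b : Bool) (x : Point d) : Bool :=
  xor b (decide (Odd (S.filter (fun i => x i = true)).card))

/-- The concept class of affine parities over `{0,1}^d`. -/
def AffParity (d : ℕ) : Set (Point d → Bool) :=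
  {f | ∃ (S : Finset (Fin d)) (b : Bool), f = affParity S b}

/-- Binary decision trees over `{0,1}^d` with real labels at the leaves. -/
inductive DecTree (d : ℕ) : Type where
  | leaf (v : ℝ) : DecTree d
  | node (i : Fin d) (left right : DecTree d) : DecTree d

/-- The number of internal nodes on a longest root-to-leaf path. -/
def DecTree.depth {d : ℕ} : DecTree d → ℕ
  | .leaf _ => 0
  | .node _ l r => max l.depth r.depth + 1

/-- The label of the leaf that `x` reaches: left at a queried `0`, right at a queried `1`. -/
def DecTree.eval {d : ℕ} : DecTree d → Point d → ℝ
  | .leaf v, _ => v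
  | .node i l r, x => if x i = true then r.eval x else l.eval x

/-- The decision tree complexity of a distribution: the least positive integer `k` such that the
probability mass function is computed by a decision tree of depth at most `k`.
A constant mass function (the uniform distribution) has complexity `1`. -/
def dtComplexity {d : ℕ} (D : Measure (Point d)) : ℕ :=
  sInf {k | 1 ≤ k ∧ ∃ T : DecTree d, T.depth ≤ k ∧ ∀ x, D.real {x} = T.eval x}

/-- A distribution is monotone if its probability mass function is. -/
def MonotoneDist {d : ℕ} (D : Measure (Point d)) : Prop :=
  ∀ x y : Point d, y ≤ x → D.real {y} ≤ D.real {x}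

/-! ### Conditional sampling -/

/-- A restriction of `{0,1}^d`: `some b` fixes a coordinate to `b`, `none` leaves it free. -/
abbrev Restriction (d : ℕ) : Type := Fin d → Option Bool

/-- The points that are consistent with a restriction. -/
def Restriction.subcube {d : ℕ} (c : Restriction d) : Set (Point d) :=
  {x | ∀ i, ∀ b, c i = some b → x i = b}

/-- `O` describes a subcube conditional sampling oracle for `D`: on every subcube of positive mass
it answers with a point drawn from `D` conditioned on that subcube. On subcubes of mass zero its
answers may have any distribution. -/
structure IsCondOracle {d : ℕ} (D : Measure (Point d))
    (O : Restriction d → Measure (Point d)) : Prop where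
  prob : ∀ c, IsProbabilityMeasure (O c)
  cond : ∀ c : Restriction d, D c.subcube ≠ 0 → O c = D[|c.subcube]

/-! ### A machine model with a step count

Programs of a first-order LISP-like language: a value is a binary tree, and the primitive
operations form a pair of two pointers, follow a pointer, and test a pointer for `nil`. Each
program node visited costs one step. This pointer machine simulates, and is simulated by, a Turing
machine with polynomial overhead. Oracle calls also cost one step each. -/

/-- The values that programs work on. -/
inductive Val : Type where
  | nil : Val
  | cons (a b : Val) : Val

def Val.hd : Val → Val
  | .nil => .nil
  | .cons a _ => a

def Val.tl : Val → Val
  | .nil => .nil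
  | .cons _ b => b

/-- Programs; each one transforms a value into a value. -/
inductive Prog : Type where
  /-- return the input -/
  | skip : Prog
  /-- return `nil` -/
  | nil : Prog
  /-- first component of the input -/
  | hd : Prog
  /-- second component of the input -/
  | tl : Prog
  /-- run both programs on the input and pair the results -/
  | pair (p q : Prog) : Prog
  /-- run `p`, then run `q` on its result -/
  | seq (p q : Prog) : Prog
  /-- run `c` on the input; if the result is not `nil` run `p` on the input, else run `q` on it -/
  | ite (c p q : Prog) : Prog
  /-- as long as `c` does not return `nil` on the current value, replace that value by the result
  of `p` on it -/
  | loop (c p : Prog) : Prog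
  /-- pass the input to the oracle and return its answer -/
  | query : Prog

/-- `Runs orc p x j y k t`: program `p`, started on the value `x` after `j` oracle calls have been
made, halts with the value `y` after `t` steps, when `k` oracle calls have been made in total.
`orc j q a` says that the oracle call with index `j` (the first one has index `0`) on the question
`q` is answered by `a`; a program that makes a call which has no answer does not halt. -/
inductive Runs (orc : ℕ → Val → Val → Prop) : Prog → Val → ℕ → Val → ℕ → ℕ → Prop where
  | skip (x : Val) (j : ℕ) : Runs orc .skip x j x j 1
  | nil (x : Val) (j : ℕ) : Runs orc .nil x j .nil j 1
  | hd (x : Val) (j : ℕ) : Runs orc .hd x j x.hd j 1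
  | tl (x : Val) (j : ℕ) : Runs orc .tl x j x.tl j 1
  | pair {p q : Prog} {x a b : Val} {j k l s t : ℕ} :
      Runs orc p x j a k s → Runs orc q x k b l t →
      Runs orc (.pair p q) x j (.cons a b) l (s + t + 1)
  | seq {p q : Prog} {x a b : Val} {j k l s t : ℕ} :
      Runs orc p x j a k s → Runs orc q a k b l t →
      Runs orc (.seq p q) x j b l (s + t + 1)
  | ite_true {c p q : Prog} {x v y : Val} {j k l s t : ℕ} :
      Runs orc c x j v k s → v ≠ .nil → Runs orc p x k y l t →
      Runs orc (.ite c p q) x j y l (s + t + 1)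
  | ite_false {c p q : Prog} {x y : Val} {j k l s t : ℕ} :
      Runs orc c x j .nil k s → Runs orc q x k y l t →
      Runs orc (.ite c p q) x j y l (s + t + 1)
  | loop_stop {c p : Prog} {x : Val} {j k s : ℕ} :
      Runs orc c x j .nil k s → Runs orc (.loop c p) x j x k (s + 1)
  | loop_step {c p : Prog} {x v y z : Val} {j k l m s t u : ℕ} :
      Runs orc c x j v k s → v ≠ .nil → Runs orc p x k y l t →
      Runs orc (.loop c p) y l z m u →
      Runs orc (.loop c p) x j z m (s + t + u + 1)
  | query {x y : Val} {j : ℕ} : orc j x y → Runs orc .query x j y (j + 1) 1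

/-! ### Encoding of inputs as values -/

def Val.ofList : List Val → Val
  | [] => .nil
  | a :: l => .cons a (Val.ofList l)

def Val.ofBool (b : Bool) : Val := if b = true then .cons .nil .nil else .nil

/-- Natural numbers in unary. -/
def Val.ofNat (n : ℕ) : Val := Val.ofList (List.replicate n .nil)

def Val.ofOptionBool : Option Bool → Val
  | none => .nil
  | some b => .cons (Val.ofBool b) .nil

def Val.ofPoint {d : ℕ} (x : Point d) : Val :=
  Val.ofList (List.ofFn fun i => Val.ofBool (x i))

def Val.ofRestriction {d : ℕ} (c : Restriction d) : Val :=
  Val.ofList (List.ofFn fun i => Val.ofOptionBool (c i))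

/-- A labelled example, as the pair of the point and its label. -/
def Val.ofExample {d : ℕ} (e : Point d × Bool) : Val :=
  .cons (Val.ofPoint e.1) (Val.ofBool e.2)

/-- The input of a learner: the list of the numerical parameters, the list of the labelled
examples, and the random string. -/
def learnerInput {d M R : ℕ} (params : List ℕ) (S : Fin M → Point d × Bool) (r : Fin R → Bool) :
    Val :=
  .cons (Val.ofList (params.map Val.ofNat))
    (.cons (Val.ofList (List.ofFn fun m => Val.ofExample (S m)))
      (Val.ofList (List.ofFn fun m => Val.ofBool (r m))))

/-- The oracle that answers the `j`-th call, `j < K`, on the restriction `c` by `w j c`. There are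
no answers to malformed questions, nor to any call after the first `K` ones. -/
def answers {d K : ℕ} (w : Fin K → Restriction d → Point d) (j : ℕ) (q a : Val) : Prop :=
  ∃ (h : j < K) (c : Restriction d), q = Val.ofRestriction c ∧ a = Val.ofPoint (w ⟨j, h⟩ c)

/-! ### Replicable learners -/

/-- The law of the data of one execution: `M` independent labelled examples `(x, f x)` with
`x ∼ D`, and independent answers to `K` calls of the conditional sampling oracle. The answer to
the `j`-th call is `w j c` if `c` is the restriction asked for, and `w j c` is drawn from `O c`;
only one of the values `w j c` is ever seen for each `j`, so that this is the law of fresh draws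
made one after the other. -/
def dataLaw {d : ℕ} (D : Measure (Point d)) (O : Restriction d → Measure (Point d))
    (f : Point d → Bool) (M K : ℕ) :
    Measure ((Fin M → Point d × Bool) × (Fin K → Restriction d → Point d)) :=
  (Measure.pi fun _ : Fin M => D.map fun x => (x, f x)).prod
    (Measure.pi fun _ : Fin K => Measure.pi fun c : Restriction d => O c)

/-- The law of a random string of `R` fair coins. -/
def coinLaw (R : ℕ) : Measure (Fin R → Bool) :=
  Measure.pi fun _ : Fin R => (PMF.uniformOfFintype Bool).toMeasure

/-- The program `P` (together with the program `E` that evaluates its hypotheses) is a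
`ρ`-replicable `(α, β)`-PAC learner for the concept class `C` over `{0,1}^d` under every
distribution in the family `𝒟`. It uses `M` labelled examples, at most `K` conditional samples and
a random string of length `R`, and both programs halt within `T` steps.
Neither the programs nor their inputs depend on the distribution or the target concept. -/
def IsReplicablePACLearner (P E : Prog) {d : ℕ} (C : Set (Point d → Bool))
    (𝒟 : Set (Measure (Point d))) (params : List ℕ) (α ρ β : ℝ) (M K R T : ℕ) : Prop :=
  -- `A` is the output of `P`, and `H o` is the hypothesis that the output `o` stands for
  ∃ (A : (Fin M → Point d × Bool) × (Fin K → Restriction d → Point d) → (Fin R → Bool) → Val)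
    (H : Val → Point d → Bool),
    -- `P` computes `A`, in time `T` in the worst case
    (∀ S w r, ∃ k t, t ≤ T ∧
      Runs (answers w) P (learnerInput params S r) 0 (A (S, w) r) k t) ∧
    -- `E` evaluates the hypotheses without any oracle, in time `T` in the worst case
    (∀ z r x, ∃ t, t ≤ T ∧
      Runs (fun _ _ _ => False) E (.cons (A z r) (Val.ofPoint x)) 0
        (Val.ofBool (H (A z r) x)) 0 t) ∧
    ∀ D ∈ 𝒟, IsProbabilityMeasure D → ∀ O, IsCondOracle D O → ∀ f ∈ C,
      -- accuracy `α` with confidence `1 - β`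
      1 - β ≤ ((dataLaw D O f M K).prod (coinLaw R)).real
        {z | D.real {x | H (A z.1 z.2) x ≠ f x} ≤ α} ∧
      -- two executions on independent data with the same random string
      (((dataLaw D O f M K).prod (dataLaw D O f M K)).prod (coinLaw R)).real
        {z | A z.1.1 z.2 ≠ A z.1.2 z.2} ≤ ρ

/-- The number `q(d, ⌈1/α⌉, ⌈1/ρ⌉, ⌈1/β⌉) ^ (c ℓ)`. -/
def sampleSize (q : MvPolynomial (Fin 4) ℕ) (c d ℓ : ℕ) (α ρ β : ℝ) : ℕ :=
  (MvPolynomial.eval ![d, ⌈1 / α⌉₊, ⌈1 / ρ⌉₊, ⌈1 / β⌉₊] q) ^ (c * ℓ)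

end

end ReplicableParity

open ReplicableParity

namespace ReplicableParity

/-! Write a point `x` as the vector `hom x = (1, x)` over the field with two elements. Affine
parities become linear functionals on a space of dimension `d + 1`, and the error of a hypothesis
`u` against the target `f` is the `mass` of `u - f`, the probability that this functional takes the
value 1. If the mass function of the distribution is a decision tree of depth at most `ℓ`, its
Fourier transform lives on characters of at most `ℓ` variables, so every functional of more
variables has mass exactly `1 / 2` (`mass_eq_half`). All other functionals lie in an explicit list
of `(d + 2) ^ (ℓ + 1)` candidates, whose masses can be estimated simultaneously.

The learner solves the linear system given by the examples. Its solution differs from `f` by a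
functional that vanishes on the sample; on a good sample no functional of mass `1 / 2` does so,
hence the difference is a candidate of empirical mass zero. Modulo the span of the candidates of
empirical mass below a threshold, the solution is therefore congruent to `f`, and the learner
outputs a canonical representative of this coset. The output is accurate because the span has a
basis of at most `d + 1` functionals of small mass (`mass_le_of_mem_level`).

It is replicable if two samples yield the same span. The spans of the candidates of true mass at
most `θ` increase with `θ`, so they grow at most `d + 1` times (`card_jumps_le`), and away from
these jumps every good sample finds the same span. The threshold is taken from the shared coins: the
number of true bits among `4 k ^ 2` of them, no value of which has probability above `1 / (2 k)`
(`coinLaw_count_le`). A union bound over the jumps finishes the argument.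

The programs are verified with `Computes`, whose rules bound the running times. A single pair
`learnP`, `evalP` without oracle calls serves both parts. -/

/-! ### A calculus of running times for programs without oracle calls -/

/-- `p` maps `x` to `y` in at most `T` steps, without oracle calls. -/
def Computes (p : Prog) (x y : Val) (T : ℕ) : Prop :=
  -- The step count is chosen before the oracle, so the same bound applies to runs with and without
  -- one.
  ∃ t ≤ T, ∀ orc j, Runs orc p x j y j t

namespace Computes

theorem mono {p : Prog} {x y : Val} {S T : ℕ} (h : Computes p x y S) (hST : S ≤ T) :
    Computes p x y T := by
  obtain ⟨t, ht, h⟩ := h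
  exact ⟨t, ht.trans hST, h⟩

theorem pair {p q : Prog} {x a b : Val} {S T : ℕ} (hp : Computes p x a S)
    (hq : Computes q x b T) : Computes (.pair p q) x (.cons a b) (S + T + 1) := by
  obtain ⟨s, hs, hp⟩ := hp
  obtain ⟨t, ht, hq⟩ := hq
  exact ⟨s + t + 1, by omega, fun o j => .pair (hp o j) (hq o j)⟩

theorem seq {p q : Prog} {x a b : Val} {S T : ℕ} (hp : Computes p x a S)
    (hq : Computes q a b T) : Computes (.seq p q) x b (S + T + 1) := by
  obtain ⟨s, hs, hp⟩ := hp
  obtain ⟨t, ht, hq⟩ := hq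
  exact ⟨s + t + 1, by omega, fun o j => .seq (hp o j) (hq o j)⟩

theorem cast {p : Prog} {x y z : Val} {T : ℕ} (h : Computes p x y T) (e : y = z) :
    Computes p x z T := e ▸ h

/-- The branch is chosen by a Boolean test. -/
theorem ite {c p q : Prog} {x y : Val} {b : Bool} {S T U : ℕ}
    (hc : Computes c x (Val.ofBool b) S) (hp : b = true → Computes p x y T)
    (hq : b = false → Computes q x y U) :
    Computes (.ite c p q) x y (S + (T + U) + 1) := by
  obtain ⟨s, hs, hc⟩ := hc
  cases b
  · obtain ⟨t, ht, hq⟩ := hq rfl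
    exact ⟨s + t + 1, by omega, fun o j => .ite_false (hc o j) (hq o j)⟩
  · obtain ⟨t, ht, hp⟩ := hp rfl
    exact ⟨s + t + 1, by omega, fun o j => .ite_true (hc o j) (by simp [Val.ofBool]) (hp o j)⟩

end Computes

/-- The result of a program without branches, loops and oracle calls. -/
def Prog.run : Prog → Val → Val
  | .nil, _ => .nil
  | .hd, x => x.hd
  | .tl, x => x.tl
  | .pair p q, x => .cons (p.run x) (q.run x)
  | .seq p q, x => q.run (p.run x)
  -- Correct for `skip`; a junk value for `ite`, `loop` and `query`, which `Prog.straight` excludes.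
  | _, x => x

/-- The number of steps of a program without branches, loops and oracle calls. -/
def Prog.cost : Prog → ℕ
  | .pair p q => p.cost + q.cost + 1
  | .seq p q => p.cost + q.cost + 1
  | _ => 1

/-- The program has no branches, loops and oracle calls. -/
def Prog.straight : Prog → Bool
  | .ite _ _ _ => false
  | .loop _ _ => false
  | .query => false
  | .pair p q => p.straight && q.straight
  | .seq p q => p.straight && q.straight
  | _ => true

theorem Prog.computes_run {p : Prog} (hp : p.straight = true) (x : Val) :
    Computes p x (p.run x) p.cost := by
  induction p generalizing x with
  | skip => exact ⟨1, le_rfl, fun _ _ => .skip _ _⟩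
  | nil => exact ⟨1, le_rfl, fun _ _ => .nil _ _⟩
  | hd => exact ⟨1, le_rfl, fun _ _ => .hd _ _⟩
  | tl => exact ⟨1, le_rfl, fun _ _ => .tl _ _⟩
  | pair p q hp' hq' =>
    simp only [Prog.straight, Bool.and_eq_true] at hp
    exact (hp' hp.1 x).pair (hq' hp.2 x)
  | seq p q hp' hq' =>
    simp only [Prog.straight, Bool.and_eq_true] at hp
    exact (hp' hp.1 x).seq (hq' hp.2 _)
  | ite => simp [Prog.straight] at hp
  | loop => simp [Prog.straight] at hp
  | query => simp [Prog.straight] at hp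

/-- Straight-line programs are verified by evaluation: both side conditions default to `rfl`, so the
moving of data in later programs needs no proof. -/
theorem Computes.straight {p : Prog} {x y : Val} (hp : p.straight = true := by rfl)
    (hy : p.run x = y := by rfl) : Computes p x y p.cost :=
  hy ▸ Prog.computes_run hp x

/-! ### Loops as folds over lists -/

/-- On `(list, (acc, env))`: fold the list, where `step` maps `(element, (acc, env))` to the new
value of `acc`. -/
def foldP (step : Prog) : Prog :=
  .seq (.loop .hd (.pair (.seq .hd .tl)
    (.pair (.seq (.pair (.seq .hd .hd) .tl) step) (.seq .tl .tl)))) (.seq .tl .hd)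

theorem Computes.loop_exit {c p : Prog} {x : Val} {S : ℕ} (hc : Computes c x .nil S) :
    Computes (.loop c p) x x (S + 1) := by
  obtain ⟨s, hs, hc⟩ := hc
  exact ⟨s + 1, by omega, fun o j => Runs.loop_stop (hc o j)⟩

theorem Computes.loop_step {c p : Prog} {x v y z : Val} {S T U : ℕ} (hc : Computes c x v S)
    (hv : v ≠ .nil) (hp : Computes p x y T) (hl : Computes (.loop c p) y z U) :
    Computes (.loop c p) x z (S + T + U + 1) := by
  obtain ⟨s, hs, hc⟩ := hc
  obtain ⟨t, ht, hp⟩ := hp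
  obtain ⟨u, hu, hl⟩ := hl
  exact ⟨s + t + u + 1, by omega, fun o j => .loop_step (hc o j) hv (hp o j) (hl o j)⟩

/-- Loop rule with an invariant: `st j` is the accumulator after `j` elements and may depend on the
position. The 16 extra steps per element pay for the loop test and for repacking the state. -/
theorem Computes.fold_states {step : Prog} {env : Val} (L : List Val) (st : ℕ → Val) (T : ℕ)
    (h : ∀ j (hj : j < L.length),
      Computes step (.cons L[j] (.cons (st j) env)) (st (j + 1)) T) :
    Computes (foldP step) (.cons (Val.ofList L) (.cons (st 0) env)) (st L.length)
      (L.length * (T + 16) + 6) := by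
  have key : Computes (.loop .hd (.pair (.seq .hd .tl)
      (.pair (.seq (.pair (.seq .hd .hd) .tl) step) (.seq .tl .tl))))
      (.cons (Val.ofList L) (.cons (st 0) env)) (.cons .nil (.cons (st L.length) env))
      (L.length * (T + 16) + 2) := by
    induction L generalizing st with
    | nil =>
      refine (Computes.loop_exit (S := 1) ?_).mono (by simp)
      exact Computes.straight
    | cons a l ih =>
      have h0 := h 0 (by simp)
      have ih' := ih (fun j => st (j + 1)) fun j hj => by
        exact h (j + 1) (by simpa using hj)
      refine (Computes.loop_step (S := 1) (v := .cons a (Val.ofList l)) (T := T + 14)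
        Computes.straight (by simp) ?_ ih').mono ?_
      · exact (((Computes.straight (p := .seq .hd .tl)).pair
          (((Computes.straight (p := .pair (.seq .hd .hd) .tl)).seq h0).pair
            (Computes.straight (p := .seq .tl .tl))))).mono (by simp [Prog.cost]; omega)
      · simp only [List.length_cons]
        ring_nf; omega
  exact (key.seq (Computes.straight (p := .seq .tl .hd))).mono (by simp [Prog.cost])

theorem Computes.fold {α β : Type*} {step : Prog} {env : Val} (L : List α) (eA : α → Val)
    (eB : β → Val) (F : β → α → β) (b : β) (T : ℕ)
    (h : ∀ a ∈ L, ∀ b, Computes step (.cons (eA a) (.cons (eB b) env)) (eB (F b a)) T) :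
    Computes (foldP step) (.cons (Val.ofList (L.map eA)) (.cons (eB b) env)) (eB (L.foldl F b))
      (L.length * (T + 16) + 6) := by
  have := Computes.fold_states (step := step) (env := env) (L.map eA)
    (fun j => eB ((L.take j).foldl F b)) T fun j hj => by
      have hj' : j < L.length := by simpa using hj
      have := h L[j] (List.getElem_mem _) ((L.take j).foldl F b)
      simp only [List.getElem_map]
      rwa [List.take_succ_eq_append_getElem hj', List.foldl_append]
  simpa using this

/-- On `(a, b)`: the reverse of the list `a` followed by the list `b`. -/
def revAppendP : Prog :=
  .seq (.pair .hd (.pair .tl .nil)) (foldP (.pair .hd (.seq .tl .hd)))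

theorem revAppendP_computes (a b : List Val) :
    Computes revAppendP (.cons (Val.ofList a) (Val.ofList b)) (Val.ofList (a.reverse ++ b))
      (a.length * 21 + 12) := by
  have h := Computes.fold (step := .pair .hd (.seq .tl .hd)) (env := .nil) a id Val.ofList
    (fun l x => x :: l) b 5 fun x _ l => Computes.straight
  have e : a.foldl (fun l x => x :: l) b = a.reverse ++ b := by
    induction a generalizing b with
    | nil => rfl
    | cons x a ih => simp
  rw [e, List.map_id] at h
  exact ((Computes.straight (p := .pair .hd (.pair .tl .nil))).seq h).mono
    (by simp [Prog.cost]; omega)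

/-! ### Vectors over the field with two elements -/

/-- Vectors over the field with two elements. -/
abbrev Vec (n : ℕ) : Type := Fin n → ZMod 2

def encBit (c : ZMod 2) : Val := Val.ofBool (decide (c = 1))

def encVec {n : ℕ} (u : Vec n) : Val := Val.ofList (List.ofFn fun i => encBit (u i))

def encVecs {n : ℕ} (K : List (Vec n)) : Val := Val.ofList (K.map encVec)

def trueP : Prog := .pair .nil .nil

/-- On `(a, b)`: the sum of two bits. -/
def xorP : Prog := .ite .hd (.ite .tl .nil trueP) .tl

theorem zmod_two_cases (a : ZMod 2) : a = 0 ∨ a = 1 := by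
  revert a; decide

theorem xorP_computes (a b : Bool) :
    Computes xorP (.cons (Val.ofBool a) (Val.ofBool b)) (Val.ofBool (xor a b)) 10 := by
  refine Computes.mono (Computes.ite (b := a) Computes.straight (T := 6) (U := 1) (fun ha => ?_)
    fun ha => ?_) (by simp [Prog.cost])
  · refine Computes.mono (Computes.ite (b := b) Computes.straight (T := 1) (U := 3) (fun hb => ?_)
      fun hb => ?_) (by simp [Prog.cost])
    · subst ha hb; exact Computes.straight
    · subst ha hb; exact Computes.straight
  · subst ha
    cases b <;> exact Computes.straight

theorem xorP_computes_bit (a b : ZMod 2) :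
    Computes xorP (.cons (encBit a) (encBit b)) (encBit (a + b)) 10 := by
  refine (xorP_computes (decide (a = 1)) (decide (b = 1))).cast (congrArg Val.ofBool ?_)
  revert a b; decide

theorem encBit_zero : encBit 0 = .nil := rfl

theorem drop_ofFn_hd {n : ℕ} (f : Fin n → Val) {j : ℕ} (hj : j < n) :
    Val.ofList ((List.ofFn f).drop j) =
      .cons (f ⟨j, hj⟩) (Val.ofList ((List.ofFn f).drop (j + 1))) := by
  rw [List.drop_eq_getElem_cons (by simpa using hj)]
  simp [Val.ofList]

def addStep : Prog :=
  .pair (.seq (.seq .tl .hd) (.seq .hd .tl))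
    (.pair (.seq (.pair .hd (.seq (.seq .tl .hd) (.seq .hd .hd))) xorP)
      (.seq (.seq .tl .hd) .tl))

/-- On `(u, v)`: the sum of two vectors. -/
def addP : Prog :=
  .seq (.pair .hd (.pair (.pair .tl .nil) .nil))
    (.seq (foldP addStep) (.seq (.pair .tl .nil) revAppendP))

theorem addP_computes {n : ℕ} (u v : Vec n) :
    Computes addP (.cons (encVec u) (encVec v)) (encVec (u + v)) (n * 80 + 40) := by
  let w : List Val := List.ofFn fun i => encBit ((u + v) i)
  have h := Computes.fold_states (step := addStep) (env := .nil)
    (List.ofFn fun i => encBit (u i))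
    -- The accumulator holds what is left of `v` and the reversed prefix of the sum.
    (fun j => .cons (Val.ofList ((List.ofFn fun i => encBit (v i)).drop j))
      (Val.ofList (w.take j).reverse)) 40 fun j hj => by
    have hj' : j < n := by simpa using hj
    rw [drop_ofFn_hd _ hj', List.take_succ_eq_append_getElem (by simpa [w] using hj')]
    simp only [List.getElem_ofFn, List.reverse_append, List.reverse_cons, List.reverse_nil,
      List.nil_append, List.singleton_append, w, Val.ofList]
    refine Computes.mono (Computes.pair Computes.straight (Computes.pair
      (Computes.seq (Computes.straight) (xorP_computes_bit _ _))
      Computes.straight)) ?_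
    simp [Prog.cost]
  have h2 := revAppendP_computes w.reverse []
  simp only [List.length_ofFn] at h
  have hw : w.take n = w := List.take_of_length_le (by simp [w])
  rw [hw] at h
  simp only [List.reverse_reverse, List.append_nil] at h2
  refine ((Computes.straight (p := .pair .hd (.pair (.pair .tl .nil) .nil))).seq
    (h.seq ((Computes.straight (p := .pair .tl .nil)).seq h2))).mono ?_
  simp [Prog.cost, w]
  omega

def dotStep : Prog :=
  .pair (.seq (.seq .tl .hd) (.seq .hd .tl))
    (.ite .hd (.seq (.pair (.seq (.seq .tl .hd) .tl) (.seq (.seq .tl .hd) (.seq .hd .hd))) xorP)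
      (.seq (.seq .tl .hd) .tl))

/-- On `(u, v)`: the inner product of two vectors. -/
def dotP : Prog :=
  .seq (.pair .hd (.pair (.pair .tl .nil) .nil)) (.seq (foldP dotStep) .tl)

theorem dotP_computes {n : ℕ} (u v : Vec n) :
    Computes dotP (.cons (encVec u) (encVec v)) (encBit (u ⬝ᵥ v)) (n * 80 + 40) := by
  let w : List (ZMod 2) := List.ofFn fun i => u i * v i
  have h := Computes.fold_states (step := dotStep) (env := .nil)
    (List.ofFn fun i => encBit (u i))
    (fun j => .cons (Val.ofList ((List.ofFn fun i => encBit (v i)).drop j))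
      (encBit (w.take j).sum)) 40 fun j hj => by
    have hj' : j < n := by simpa using hj
    rw [drop_ofFn_hd _ hj', List.sum_take_succ _ _ (by simpa [w] using hj')]
    simp only [List.getElem_ofFn, w]
    refine Computes.mono (Computes.pair Computes.straight (Computes.ite
      (b := decide (u ⟨j, hj'⟩ = 1)) (T := 25) (U := 5)
      Computes.straight (fun h => ?_) fun h => ?_)) (by simp [Prog.cost])
    · rw [of_decide_eq_true h, one_mul]
      exact Computes.mono (Computes.seq Computes.straight (xorP_computes_bit _ (v ⟨j, hj'⟩)))
        (by simp [Prog.cost])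
    · rw [(zmod_two_cases _).resolve_right (of_decide_eq_false h), zero_mul, add_zero]
      exact Computes.straight
  simp only [List.length_ofFn] at h
  have hw : w.take n = w := List.take_of_length_le (by simp [w])
  have hs : w.sum = u ⬝ᵥ v := by simp [w, List.sum_ofFn, dotProduct]
  rw [hw, hs] at h
  refine ((Computes.straight (p := .pair .hd (.pair (.pair .tl .nil) .nil))).seq
    (h.seq Computes.straight)).mono ?_
  simp [Prog.cost]
  omega

/-! ### Elimination -/

section Elimination

variable {n : ℕ}

/-- An element of `K` that is not orthogonal to `z`, or `0` if there is none. -/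
def pivot (z : Vec n) (K : List (Vec n)) : Vec n :=
  -- With the default `0`, an elimination step against a `z` orthogonal to all of `K` changes
  -- neither the vector nor the span.
  K.foldl (fun p u => if u ⬝ᵥ z = 1 then u else p) 0

def reduce (z p u : Vec n) : Vec n := if u ⬝ᵥ z = 1 then u + p else u

/-- Replace the affine space `f + span K` by its subspace of the vectors whose inner product with
`z` is `y`, if there are any. -/
def elim (z : Vec n) (y : ZMod 2) (s : Vec n × List (Vec n)) : Vec n × List (Vec n) :=
  (if s.1 ⬝ᵥ z + y = 1 then s.1 + pivot z s.2 else s.1,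
    s.2.foldl (fun K u => reduce z (pivot z s.2) u :: K) [])

def elimAll (cs : List (Vec n × ZMod 2)) (s : Vec n × List (Vec n)) : Vec n × List (Vec n) :=
  cs.foldl (fun s c => elim c.1 c.2 s) s

/-- The linear span of the members of a list. -/
def listSpan (K : List (Vec n)) : Submodule (ZMod 2) (Vec n) :=
  Submodule.span (ZMod 2) {u | u ∈ K}

theorem pivot_spec (z : Vec n) (K : List (Vec n)) :
    (pivot z K ∈ K ∧ pivot z K ⬝ᵥ z = 1) ∨ (pivot z K = 0 ∧ ∀ u ∈ K, u ⬝ᵥ z = 0) := by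
  unfold pivot
  induction K using List.reverseRecOn with
  | nil => simp
  | append_singleton K a ih =>
    simp only [List.foldl_append, List.foldl_cons, List.foldl_nil, List.mem_append,
      List.mem_singleton]
    by_cases h : a ⬝ᵥ z = 1
    · simp [h]
    · rw [if_neg h]
      rcases ih with ih | ih
      · exact .inl ⟨.inl ih.1, ih.2⟩
      · refine .inr ⟨ih.1, ?_⟩
        rintro u (hu | rfl)
        · exact ih.2 u hu
        · exact (zmod_two_cases _).resolve_right h

/-- Turns the case distinctions of the elimination into linear algebra. -/
theorem ite_add_eq_smul (c : ZMod 2) (f p : Vec n) :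
    (if c = 1 then f + p else f) = f + c • p := by
  rcases zmod_two_cases c with rfl | rfl <;> simp

theorem dotProduct_eq_zero_of_mem_span {z : Vec n} {K : List (Vec n)}
    (h : ∀ u ∈ K, u ⬝ᵥ z = 0) {u : Vec n} (hu : u ∈ listSpan K) : u ⬝ᵥ z = 0 := by
  induction hu using Submodule.span_induction with
  | mem x hx => exact h x hx
  | zero => simp
  | add x y _ _ hx hy => rw [add_dotProduct, hx, hy, add_zero]
  | smul a x _ hx => rw [smul_dotProduct, hx, smul_zero]

theorem pivot_mem_span (z : Vec n) (K : List (Vec n)) : pivot z K ∈ listSpan K := by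
  rcases pivot_spec z K with h | h
  · exact Submodule.subset_span h.1
  · rw [h.1]; exact zero_mem _

theorem elim_fst_sub_mem (z : Vec n) (y : ZMod 2) (s : Vec n × List (Vec n)) :
    (elim z y s).1 - s.1 ∈ listSpan s.2 := by
  simp only [elim, ite_add_eq_smul, add_sub_cancel_left]
  exact Submodule.smul_mem _ _ (pivot_mem_span _ _)

/-- `reduce` as a linear map. -/
def reduceLin (z p : Vec n) : Vec n →ₗ[ZMod 2] Vec n where
  toFun u := reduce z p u
  map_add' u v := by
    simp only [reduce, ite_add_eq_smul, add_dotProduct, add_smul]; abel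
  map_smul' c u := by
    simp only [reduce, ite_add_eq_smul, smul_dotProduct, RingHom.id_apply, smul_add, smul_assoc]

/-- `reduce` is linear, maps the span into its intersection with the hyperplane orthogonal to `z`,
and fixes every vector of that intersection, which is therefore its image. -/
theorem mem_span_elim (z : Vec n) (y : ZMod 2) (s : Vec n × List (Vec n)) (u : Vec n) :
    u ∈ listSpan (elim z y s).2 ↔ u ∈ listSpan s.2 ∧ u ⬝ᵥ z = 0 := by
  have e : listSpan (elim z y s).2 = (listSpan s.2).map (reduceLin z (pivot z s.2)) := by
    rw [listSpan, listSpan, Submodule.map_span]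
    congr 1
    ext v
    simp [elim, reduceLin]
  rw [e, Submodule.mem_map]
  constructor
  · rintro ⟨v, hv, rfl⟩
    refine ⟨?_, ?_⟩
    · simp only [reduceLin, LinearMap.coe_mk, AddHom.coe_mk, reduce, ite_add_eq_smul]
      exact add_mem hv (Submodule.smul_mem _ _ (pivot_mem_span _ _))
    · simp only [reduceLin, LinearMap.coe_mk, AddHom.coe_mk, reduce, ite_add_eq_smul,
        add_dotProduct, smul_dotProduct]
      rcases pivot_spec z s.2 with h | h
      · rw [h.2, smul_eq_mul, mul_one]
        exact CharTwo.add_self_eq_zero _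
      · rw [h.1, dotProduct_eq_zero_of_mem_span h.2 hv]; simp
  · rintro ⟨hu, hz⟩
    exact ⟨u, hu, by simp [reduceLin, reduce, hz]⟩

/-- Two states that describe the same affine space. -/
def SameSpace (s t : Vec n × List (Vec n)) : Prop :=
  listSpan s.2 = listSpan t.2 ∧ s.1 - t.1 ∈ listSpan s.2

theorem elim_fst_dotProduct {z : Vec n} (y : ZMod 2) {s : Vec n × List (Vec n)}
    (h : ∃ u ∈ listSpan s.2, u ⬝ᵥ z ≠ 0) : (elim z y s).1 ⬝ᵥ z = y := by
  obtain ⟨u, hu, hz⟩ := h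
  rcases pivot_spec z s.2 with h | h
  · simp only [elim, ite_add_eq_smul, add_dotProduct, smul_dotProduct, h.2, smul_eq_mul, mul_one,
      ← add_assoc, CharTwo.add_self_eq_zero, zero_add]
  · exact (hz (dotProduct_eq_zero_of_mem_span h.2 hu)).elim

/-- If the span is not orthogonal to `z`, both new base points satisfy the constraint; if it is,
their difference, a member of the span, is orthogonal to `z` anyway. So constraints that cannot be
enforced do no harm. -/
theorem SameSpace.elim {s t : Vec n × List (Vec n)} (h : SameSpace s t) (z : Vec n) (y : ZMod 2) :
    SameSpace (elim z y s) (elim z y t) := by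
  refine ⟨?_, ?_⟩
  · ext u
    rw [mem_span_elim, mem_span_elim, h.1]
  · rw [mem_span_elim]
    have hd : (ReplicableParity.elim z y s).1 - (ReplicableParity.elim z y t).1
        = ((ReplicableParity.elim z y s).1 - s.1) + (s.1 - t.1)
          - ((ReplicableParity.elim z y t).1 - t.1) := by abel
    have hm : (ReplicableParity.elim z y s).1 - (ReplicableParity.elim z y t).1
        ∈ listSpan s.2 := by
      rw [hd]
      exact sub_mem (add_mem (elim_fst_sub_mem z y s) h.2) (h.1 ▸ elim_fst_sub_mem z y t)
    refine ⟨hm, ?_⟩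
    by_cases hz : ∃ u ∈ listSpan s.2, u ⬝ᵥ z ≠ 0
    · rw [sub_dotProduct, elim_fst_dotProduct y hz, elim_fst_dotProduct y (h.1 ▸ hz), sub_self]
    · push Not at hz
      exact hz _ hm

theorem SameSpace.elimAll {s t : Vec n × List (Vec n)} (h : SameSpace s t)
    (cs : List (Vec n × ZMod 2)) : SameSpace (elimAll cs s) (elimAll cs t) := by
  induction cs generalizing s t with
  | nil => exact h
  | cons c cs ih => exact ih (h.elim c.1 c.2)

theorem mem_span_elimAll (cs : List (Vec n × ZMod 2)) (s : Vec n × List (Vec n)) (u : Vec n) :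
    u ∈ listSpan (elimAll cs s).2 ↔ u ∈ listSpan s.2 ∧ ∀ c ∈ cs, u ⬝ᵥ c.1 = 0 := by
  induction cs generalizing s with
  | nil => simp [elimAll]
  | cons c cs ih =>
    rw [show elimAll (c :: cs) s = elimAll cs (ReplicableParity.elim c.1 c.2 s) from rfl, ih,
      mem_span_elim]
    simp [and_assoc]

theorem elimAll_fst_sub_mem (cs : List (Vec n × ZMod 2)) (s : Vec n × List (Vec n)) :
    (elimAll cs s).1 - s.1 ∈ listSpan s.2 := by
  induction cs generalizing s with
  | nil => simp [elimAll]
  | cons c cs ih =>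
    have h1 := ((mem_span_elim c.1 c.2 s _).1 (ih (elim c.1 c.2 s))).1
    have h2 := add_mem h1 (elim_fst_sub_mem c.1 c.2 s)
    rwa [sub_add_sub_cancel] at h2

theorem elimAll_fst_of_solution {cs : List (Vec n × ZMod 2)} {f : Vec n} {K : List (Vec n)}
    (h : ∀ c ∈ cs, f ⬝ᵥ c.1 = c.2) : (elimAll cs (f, K)).1 = f := by
  induction cs generalizing K with
  | nil => rfl
  | cons c cs ih =>
    have hc : elim c.1 c.2 (f, K) = (f, (elim c.1 c.2 (f, K)).2) := by
      refine Prod.ext ?_ rfl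
      simp [elim, h c (by simp), CharTwo.add_self_eq_zero]
    rw [show elimAll (c :: cs) (f, K) = elimAll cs (elim c.1 c.2 (f, K)) from rfl, hc]
    exact ih fun c hc => h c (by simp [hc])

/-- Elimination over a solvable system finds a solution. -/
theorem elimAll_sub_dotProduct {cs : List (Vec n × ZMod 2)} {s : Vec n × List (Vec n)}
    (hs : listSpan s.2 = ⊤) {f : Vec n} (h : ∀ c ∈ cs, f ⬝ᵥ c.1 = c.2) :
    ∀ c ∈ cs, ((elimAll cs s).1 - f) ⬝ᵥ c.1 = 0 := by
  -- As the span is the whole space, the run can be compared with the one that starts at the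
  -- solution `f`, which elimination never moves.
  have := (SameSpace.elimAll (s := s) (t := (f, s.2)) ⟨rfl, by simp [hs]⟩ cs).2
  rw [elimAll_fst_of_solution h] at this
  exact ((mem_span_elimAll cs s _).1 this).2

/-- Elimination over a complete system yields a canonical representative of the affine space. -/
theorem SameSpace.elimAll_fst_eq {s t : Vec n × List (Vec n)} (h : SameSpace s t)
    {cs : List (Vec n × ZMod 2)} (hcs : ∀ u : Vec n, (∀ c ∈ cs, u ⬝ᵥ c.1 = 0) → u = 0) :
    (ReplicableParity.elimAll cs s).1 = (ReplicableParity.elimAll cs t).1 := by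
  -- The base points differ by a member of the final span, and a complete system shrinks this span
  -- to zero.
  have := (h.elimAll cs).2
  rw [mem_span_elimAll] at this
  exact sub_eq_zero.1 (hcs _ this.2)

end Elimination

/-! ### Programs for elimination -/

section ElimProgram

variable {n : ℕ}

/-- On `(u, (p, z))`: `u` if it is not orthogonal to `z`, else `p`. -/
def pivotStep : Prog :=
  .ite (.seq (.pair .hd (.seq .tl .tl)) dotP) .hd (.seq .tl .hd)

/-- On `(z, K)`: the pivot. -/
def pivotP : Prog :=
  .seq (.pair .tl (.pair (.seq (.pair .hd .hd) addP) .hd)) (foldP pivotStep)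

theorem pivotP_computes (z : Vec n) (K : List (Vec n)) :
    Computes pivotP (.cons (encVec z) (encVecs K)) (encVec (pivot z K))
      (K.length * (n * 80 + 80) + n * 80 + 80) := by
  have h := Computes.fold (step := pivotStep) (env := encVec z) K encVec encVec
    (fun p u => if u ⬝ᵥ z = 1 then u else p) 0 (n * 80 + 60) fun u _ p => by
    refine Computes.mono (Computes.ite (b := decide (u ⬝ᵥ z = 1)) (T := 1) (U := 3)
      (Computes.seq Computes.straight (dotP_computes u z)) (fun h => ?_) fun h => ?_)
      (by simp [Prog.cost]; omega)
    · rw [if_pos (of_decide_eq_true h)]; exact Computes.straight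
    · rw [if_neg (of_decide_eq_false h)]; exact Computes.straight
  -- `z + z` supplies the zero vector of the right length as the initial pivot.
  have h0 := addP_computes z z
  rw [show z + z = 0 from funext fun i => CharTwo.add_self_eq_zero _] at h0
  refine Computes.mono (Computes.seq (Computes.pair Computes.straight
    (Computes.pair (Computes.seq Computes.straight h0) Computes.straight)) h) ?_
  simp [Prog.cost]; ring_nf; omega

/-- On `(u, (K, (p, z)))`: the list `K` extended by the reduction of `u`. -/
def reduceStep : Prog :=
  .pair (.ite (.seq (.pair .hd (.seq .tl (.seq .tl .tl))) dotP)
    (.seq (.pair .hd (.seq .tl (.seq .tl .hd))) addP) .hd) (.seq .tl .hd)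

/-- On `(p, (z, K))`: the reductions of the members of `K`. -/
def reduceP : Prog :=
  .seq (.pair (.seq .tl .tl) (.pair .nil (.pair .hd (.seq .tl .hd)))) (foldP reduceStep)

theorem reduceP_computes (z p : Vec n) (K : List (Vec n)) :
    Computes reduceP (.cons (encVec p) (.cons (encVec z) (encVecs K)))
      (encVecs (K.foldl (fun K u => reduce z p u :: K) []))
      (K.length * (n * 160 + 160) + 40) := by
  have h := Computes.fold (step := reduceStep) (env := .cons (encVec p) (encVec z)) K encVec encVecs
    (fun K u => reduce z p u :: K) [] (n * 160 + 120) fun u _ L => by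
    refine Computes.mono (Computes.pair (a := encVec (reduce z p u)) (Computes.ite
      (b := decide (u ⬝ᵥ z = 1)) (T := n * 80 + 60) (U := 1)
      (Computes.seq Computes.straight (dotP_computes u z)) (fun h => ?_) fun h => ?_)
      Computes.straight) (by simp [Prog.cost]; omega)
    · rw [reduce, if_pos (of_decide_eq_true h)]
      exact Computes.mono (Computes.seq Computes.straight (addP_computes u p))
        (by simp [Prog.cost]; omega)
    · rw [reduce, if_neg (of_decide_eq_false h)]; exact Computes.straight
  refine Computes.mono (Computes.seq Computes.straight h) ?_
  simp [Prog.cost]; ring_nf; omega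

/-- On `(p, (z, (y, f)))`: the corrected vector. -/
def correctP : Prog :=
  .ite (.seq (.pair (.seq (.pair (.seq .tl (.seq .tl .tl)) (.seq .tl .hd)) dotP)
      (.seq .tl (.seq .tl .hd))) xorP)
    (.seq (.pair (.seq .tl (.seq .tl .tl)) .hd) addP) (.seq .tl (.seq .tl .tl))

theorem correctP_computes (z p f : Vec n) (y : ZMod 2) :
    Computes correctP (.cons (encVec p) (.cons (encVec z) (.cons (encBit y) (encVec f))))
      (encVec (if f ⬝ᵥ z + y = 1 then f + p else f)) (n * 160 + 160) := by
  refine Computes.mono (Computes.ite (b := decide (f ⬝ᵥ z + y = 1)) (T := n * 80 + 60) (U := 5)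
    (Computes.seq (Computes.pair (Computes.seq Computes.straight (dotP_computes f z))
      Computes.straight) (xorP_computes_bit _ y)) (fun h => ?_) fun h => ?_)
      (by simp [Prog.cost]; omega)
  · rw [if_pos (of_decide_eq_true h)]
    exact Computes.mono (Computes.seq Computes.straight (addP_computes f p))
      (by simp [Prog.cost]; omega)
  · rw [if_neg (of_decide_eq_false h)]; exact Computes.straight

def encState (s : Vec n × List (Vec n)) : Val := .cons (encVec s.1) (encVecs s.2)

/-- On `(z, (y, (f, K)))`: one step of the elimination. -/
def elimP : Prog :=
  .seq (.pair (.seq (.pair .hd (.seq .tl (.seq .tl .tl))) pivotP) .skip)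
    (.pair
      (.seq (.pair .hd (.pair (.seq .tl .hd) (.pair (.seq .tl (.seq .tl .hd))
        (.seq .tl (.seq .tl (.seq .tl .hd)))))) correctP)
      (.seq (.pair .hd (.pair (.seq .tl .hd) (.seq .tl (.seq .tl (.seq .tl .tl))))) reduceP))

def elimT (n k : ℕ) : ℕ := (k + 1) * (n * 400 + 500)

theorem elimP_computes (z : Vec n) (y : ZMod 2) (s : Vec n × List (Vec n)) :
    Computes elimP (.cons (encVec z) (.cons (encBit y) (encState s))) (encState (elim z y s))
      (elimT n s.2.length) := by
  refine Computes.mono (Computes.seq (Computes.pair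
    (Computes.seq Computes.straight (pivotP_computes z s.2)) Computes.straight)
    (Computes.pair (Computes.seq Computes.straight (correctP_computes z (pivot z s.2) s.1 y))
      (Computes.seq Computes.straight (reduceP_computes z (pivot z s.2) s.2)))) ?_
  simp [Prog.cost, elimT]; ring_nf; omega

theorem length_elim (z : Vec n) (y : ZMod 2) (s : Vec n × List (Vec n)) :
    (elim z y s).2.length = s.2.length := by
  simp [elim]

/-- A fold of elimination steps, for constraints in any encoding. -/
theorem elimAll_computes {α : Type*} {step : Prog} (eA : α → Val) (g : α → Vec n × ZMod 2)
    (C : ℕ) (hstep : ∀ a s, Computes step (.cons (eA a) (.cons (encState s) .nil))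
      (encState (elim (g a).1 (g a).2 s)) (elimT n s.2.length + C))
    (L : List α) (s : Vec n × List (Vec n)) :
    Computes (foldP step) (.cons (Val.ofList (L.map eA)) (.cons (encState s) .nil))
      (encState (elimAll (L.map g) s)) (L.length * (elimT n s.2.length + C + 16) + 6) := by
  -- Elimination never discards list members, even if they become zero, so all steps have the same
  -- time bound.
  have hlen : ∀ l : List α, (elimAll (l.map g) s).2.length = s.2.length := by
    intro l
    induction l using List.reverseRecOn with
    | nil => rfl
    | append_singleton l a ih =>
      simp only [elimAll, List.map_append, List.foldl_append, List.map_cons, List.map_nil,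
        List.foldl_cons, List.foldl_nil] at ih ⊢
      rw [length_elim, ih]
  have := Computes.fold_states (step := step) (env := .nil) (L.map eA)
    (fun j => encState (elimAll ((L.take j).map g) s)) (elimT n s.2.length + C) fun j hj => by
      have hj' : j < L.length := by simpa using hj
      have := hstep L[j] (elimAll ((L.take j).map g) s)
      rw [hlen] at this
      simp only [List.getElem_map]
      rw [List.take_succ_eq_append_getElem hj']
      simpa only [elimAll, List.map_append, List.foldl_append, List.map_cons, List.map_nil,
        List.foldl_cons, List.foldl_nil] using this
  simp only [List.length_map, List.take_length] at this
  exact this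

end ElimProgram

/-! ### Vectors of small weight -/

section Candidates

variable {n : ℕ}

/-- Add to the list `out` the vectors that differ from `u` in one coordinate. -/
def flipsOnto (u : Vec n) (out : List (Vec n)) : List (Vec n) :=
  (List.finRange n).foldl (fun out i => (u + Pi.single i 1) :: out) out

/-- The standard basis. -/
def basisList (n : ℕ) : List (Vec n) := flipsOnto 0 []

def expand (L : List (Vec n)) : List (Vec n) := L.foldl (fun out u => flipsOnto u out) L

/-- A list of the vectors of weight at most `k`. -/
def candidates (n k : ℕ) : List (Vec n) := expand^[k] [0]

theorem mem_flipsOnto {u v : Vec n} {out : List (Vec n)} :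
    v ∈ flipsOnto u out ↔ v ∈ out ∨ ∃ i, v = u + Pi.single i 1 := by
  simp [flipsOnto, eq_comm (b := v), or_comm]

theorem length_flipsOnto (u : Vec n) (out : List (Vec n)) :
    (flipsOnto u out).length = out.length + n := by
  simp [flipsOnto]; omega

theorem mem_basisList {v : Vec n} : v ∈ basisList n ↔ ∃ i, v = Pi.single i 1 := by
  simp [basisList, mem_flipsOnto]

theorem length_basisList (n : ℕ) : (basisList n).length = n := by
  simp [basisList, length_flipsOnto]

theorem span_basisList (n : ℕ) : listSpan (basisList n) = ⊤ := by
  refine eq_top_iff.2 fun v _ => ?_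
  have : v = ∑ i, v i • (Pi.single i 1 : Vec n) := by
    ext j; simp [Finset.sum_apply, Pi.single_apply]
  rw [this]
  exact sum_mem fun i _ => Submodule.smul_mem _ _ (Submodule.subset_span (mem_basisList.2 ⟨i, rfl⟩))

theorem eq_zero_of_orthogonal_basisList {u : Vec n} (h : ∀ v ∈ basisList n, u ⬝ᵥ v = 0) :
    u = 0 := by
  ext i
  simpa using h _ (mem_basisList.2 ⟨i, rfl⟩)

theorem mem_foldl_flipsOnto {L : List (Vec n)} {out : List (Vec n)} {v : Vec n} :
    v ∈ L.foldl (fun out u => flipsOnto u out) out ↔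
      v ∈ out ∨ ∃ u ∈ L, ∃ i, v = u + Pi.single i 1 := by
  induction L generalizing out with
  | nil => simp
  | cons a L ih => simp [ih, mem_flipsOnto, or_assoc]

theorem length_expand (L : List (Vec n)) : (expand L).length = (n + 1) * L.length := by
  have : ∀ out : List (Vec n), (L.foldl (fun out u => flipsOnto u out) out).length
      = out.length + n * L.length := by
    induction L with
    | nil => simp
    | cons a L ih =>
      intro out
      rw [List.foldl_cons, ih, length_flipsOnto, List.length_cons]; ring
  rw [expand, this]; ring

theorem length_candidates (n k : ℕ) : (candidates n k).length = (n + 1) ^ k := by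
  induction k with
  | zero => rfl
  | succ k ih =>
    rw [candidates, Function.iterate_succ_apply', length_expand, ← candidates, ih, pow_succ']

theorem candidates_succ (n k : ℕ) : candidates n (k + 1) = expand (candidates n k) :=
  Function.iterate_succ_apply' expand k [0]

/-- Flipping a nonzero coordinate lowers the weight by one, so `u` is one flip away from a member of
the previous list. -/
theorem mem_candidates {k : ℕ} {u : Vec n} (h : (Finset.univ.filter fun i => u i ≠ 0).card ≤ k) :
    u ∈ candidates n k := by
  induction k generalizing u with
  | zero =>
    have : u = 0 := by
      ext i
      by_contra (hi : u i ≠ 0)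
      have hm : i ∈ Finset.univ.filter fun i => u i ≠ 0 := by simpa using hi
      have := Finset.card_pos.2 ⟨i, hm⟩
      omega
    simp [candidates, this]
  | succ k ih =>
    rw [candidates_succ, expand, mem_foldl_flipsOnto]
    by_cases hu : u = 0
    · subst hu
      exact .inl (ih (by simp))
    · obtain ⟨i, hi⟩ := Function.ne_iff.1 hu
      replace hi : u i ≠ 0 := hi
      refine .inr ⟨u + Pi.single i 1, ih ?_, i, ?_⟩
      · have hsub : (Finset.univ.filter fun j => (u + Pi.single i 1 : Vec n) j ≠ 0) ⊆
            (Finset.univ.filter fun j => u j ≠ 0).erase i := by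
          intro j hj
          simp only [Finset.mem_filter, Finset.mem_univ, true_and, Finset.mem_erase] at hj ⊢
          by_cases hji : j = i
          · subst hji
            have : u j = 1 := (zmod_two_cases _).resolve_left hi
            rw [Pi.add_apply, Pi.single_eq_same, this] at hj
            exact (hj (CharTwo.add_self_eq_zero _)).elim
          · exact ⟨hji, by simpa [hji] using hj⟩
        have hc := Finset.card_le_card hsub
        rw [Finset.card_erase_of_mem (Finset.mem_filter.2 ⟨Finset.mem_univ i, hi⟩)] at hc
        omega
      · rw [add_assoc, ← Pi.single_add, CharTwo.add_self_eq_zero, Pi.single_zero, add_zero]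

/-! ### Programs that list the vectors of small weight -/

/-- On `(b, ((pre, (rest, out)), env))`. -/
def flipStep : Prog :=
  .pair (.pair .hd (.seq (.seq .tl .hd) .hd))
    (.pair (.seq (.seq .tl .hd) (.seq .tl (.seq .hd .tl)))
      (.pair (.seq (.pair (.seq (.seq .tl .hd) .hd)
          (.pair (.seq (.pair .hd trueP) xorP)
            (.seq (.seq .tl .hd) (.seq .tl (.seq .hd .tl))))) revAppendP)
        (.seq (.seq .tl .hd) (.seq .tl .tl))))

/-- On `(u, out)`: `flipsOnto u out`. -/
def flipsP : Prog :=
  .seq (.pair .hd (.pair (.pair .nil (.pair .hd .tl)) .nil)) (.seq (foldP flipStep) (.seq .tl .tl))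

theorem ofFn_flip (u : Vec n) {j : ℕ} (hj : j < n) :
    (List.ofFn fun i => encBit ((u + Pi.single ⟨j, hj⟩ 1 : Vec n) i)) =
      (List.ofFn fun i => encBit (u i)).take j ++
        encBit (u ⟨j, hj⟩ + 1) :: (List.ofFn fun i => encBit (u i)).drop (j + 1) := by
  rw [← List.set_eq_take_append_cons_drop.trans (if_pos (by simpa using hj))]
  refine List.ext_getElem (by simp) fun i h1 h2 => ?_
  simp only [List.getElem_ofFn, List.getElem_set]
  by_cases hij : j = i
  · subst hij; simp
  · rw [if_neg hij]
    have : (⟨i, by simpa using h1⟩ : Fin n) ≠ ⟨j, hj⟩ := fun h => hij (Fin.mk.inj_iff.1 h).symm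
    simp [this]

def flipsT (n : ℕ) : ℕ := n * (n * 21 + 120) + 60

theorem flipsP_computes (u : Vec n) (out : List (Vec n)) :
    Computes flipsP (.cons (encVec u) (encVecs out)) (encVecs (flipsOnto u out)) (flipsT n) := by
  let w : List Val := List.ofFn fun i => encBit (u i)
  have h := Computes.fold_states (step := flipStep) (env := .nil) w
    -- The vector is kept as a reversed prefix and a suffix; each flipped copy is rebuilt by
    -- reversing the prefix onto the flipped bit and the remainder.
    (fun j => .cons (Val.ofList (w.take j).reverse) (.cons (Val.ofList (w.drop j))
      (encVecs (((List.finRange n).take j).foldl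
        (fun out i => (u + Pi.single i 1) :: out) out)))) (n * 21 + 100) fun j hj => by
    have hj' : j < n := by simpa [w] using hj
    rw [List.take_succ_eq_append_getElem (l := List.finRange n) (by simpa using hj'),
      List.take_succ_eq_append_getElem hj, List.drop_eq_getElem_cons hj]
    have hw : w[j] = encBit (u ⟨j, hj'⟩) := by simp [w]
    simp only [hw, List.foldl_append, List.foldl_cons, List.foldl_nil, List.reverse_append,
      List.reverse_cons, List.reverse_nil, List.nil_append, List.singleton_append,
      List.getElem_finRange, Fin.cast_mk]
    have hr := revAppendP_computes (w.take j).reverse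
      (encBit (u ⟨j, hj'⟩ + 1) :: w.drop (j + 1))
    rw [List.reverse_reverse, ← ofFn_flip u hj'] at hr
    refine Computes.mono (Computes.pair Computes.straight (Computes.pair Computes.straight
      (Computes.pair (Computes.seq (Computes.pair Computes.straight (Computes.pair
        (Computes.seq (Computes.pair Computes.straight
          (Computes.straight (p := trueP) (y := encBit 1))) (xorP_computes_bit _ 1))
        Computes.straight)) hr) Computes.straight))) ?_
    simp [Prog.cost, trueP]; omega
  have hwl : w.length = n := by simp [w]
  simp only [hwl, List.take_zero, List.foldl_nil, List.drop_zero, List.reverse_nil] at h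
  rw [List.take_of_length_le (l := List.finRange n) (by simp)] at h
  refine Computes.mono (Computes.seq Computes.straight (Computes.seq h Computes.straight)) ?_
  simp [Prog.cost, flipsT]; ring_nf; omega

/-- On `L`: `expand L`. -/
def expandP : Prog :=
  .seq (.pair .skip (.pair .skip .nil)) (foldP (.seq (.pair .hd (.seq .tl .hd)) flipsP))

theorem expandP_computes (L : List (Vec n)) :
    Computes expandP (encVecs L) (encVecs (expand L)) (L.length * (flipsT n + 30) + 20) := by
  have h := Computes.fold (step := .seq (.pair .hd (.seq .tl .hd)) flipsP) (env := .nil) L encVec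
    encVecs (fun out u => flipsOnto u out) L (flipsT n + 10) fun u _ out =>
      Computes.mono (Computes.seq Computes.straight (flipsP_computes u out))
        (by simp [Prog.cost]; omega)
  refine Computes.mono (Computes.seq Computes.straight h) ?_
  simp [Prog.cost]; ring_nf; omega

/-- On `(0, ℓ)`: the vectors of weight at most `ℓ + 1`. -/
def candidatesP : Prog :=
  -- One `nil` in front of the unary `ℓ` gives `ℓ + 1` rounds; the fold starts from the list `[0]`.
  .seq (.pair (.pair .nil .tl) (.pair (.pair .hd .nil) .nil))
    (foldP (.seq (.seq .tl .hd) expandP))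

def candidatesT (n ℓ : ℕ) : ℕ := (ℓ + 1) * ((n + 1) ^ (ℓ + 1) * (flipsT n + 30) + 60) + 20

theorem candidatesP_computes (n ℓ : ℕ) :
    Computes candidatesP (.cons (encVec (0 : Vec n)) (Val.ofNat ℓ))
      (encVecs (candidates n (ℓ + 1))) (candidatesT n ℓ) := by
  have h := Computes.fold_states (step := .seq (.seq .tl .hd) expandP) (env := .nil)
    (List.replicate (ℓ + 1) .nil) (fun j => encVecs (candidates n j))
    ((n + 1) ^ (ℓ + 1) * (flipsT n + 30) + 40) fun j hj => by
    have hj' : j < ℓ + 1 := by simpa using hj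
    have := expandP_computes (candidates n j)
    rw [← candidates_succ] at this
    refine Computes.mono (Computes.seq Computes.straight this) ?_
    rw [length_candidates]
    have : (n + 1) ^ j * (flipsT n + 30) ≤ (n + 1) ^ (ℓ + 1) * (flipsT n + 30) :=
      Nat.mul_le_mul_right _ (Nat.pow_le_pow_right (by omega) hj'.le)
    simp [Prog.cost]; omega
  simp only [List.length_replicate] at h
  refine Computes.mono (Computes.seq Computes.straight h) ?_
  simp [Prog.cost, candidatesT]; ring_nf; omega

end Candidates

/-! ### Unary arithmetic -/

theorem Computes.ite_val {c p q : Prog} {x v y : Val} {S T U : ℕ}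
    (hc : Computes c x v S) (hp : v ≠ .nil → Computes p x y T)
    (hq : v = .nil → Computes q x y U) : Computes (.ite c p q) x y (S + (T + U) + 1) := by
  obtain ⟨s, hs, hc⟩ := hc
  by_cases hv : v = .nil
  · obtain ⟨t, ht, hq⟩ := hq hv
    exact ⟨s + t + 1, by omega, fun o j => .ite_false (hv ▸ hc o j) (hq o j)⟩
  · obtain ⟨t, ht, hp⟩ := hp hv
    exact ⟨s + t + 1, by omega, fun o j => .ite_true (hc o j) hv (hp o j)⟩

/-- Put the result of `p` in front of the input and continue with `q`. -/
def letP (p q : Prog) : Prog := .seq (.pair p .skip) q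

theorem Computes.letP {p q : Prog} {x a b : Val} {S T : ℕ} (hp : Computes p x a S)
    (hq : Computes q (.cons a x) b T) : Computes (letP p q) x b (S + T + 3) :=
  Computes.mono (Computes.seq (Computes.pair hp Computes.straight) hq)
    (by simp [Prog.cost]; omega)

theorem ofNat_add_computes (a b : ℕ) :
    Computes revAppendP (.cons (Val.ofNat a) (Val.ofNat b)) (Val.ofNat (a + b)) (a * 21 + 12) := by
  have := revAppendP_computes (List.replicate a .nil) (List.replicate b .nil)
  rw [List.reverse_replicate, List.replicate_append_replicate, List.length_replicate] at this
  exact this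

/-- On `(a, b)`: the product of two numbers. -/
def mulP : Prog :=
  .seq (.pair .hd (.pair .nil .tl)) (foldP (.seq (.pair (.seq .tl .tl) (.seq .tl .hd)) revAppendP))

def mulT (a b : ℕ) : ℕ := a * (b * 21 + 50) + 20

theorem mulP_computes (a b : ℕ) :
    Computes mulP (.cons (Val.ofNat a) (Val.ofNat b)) (Val.ofNat (a * b)) (mulT a b) := by
  have h := Computes.fold_states (step := .seq (.pair (.seq .tl .tl) (.seq .tl .hd)) revAppendP)
    (env := Val.ofNat b) (List.replicate a .nil) (fun j => Val.ofNat (j * b)) (b * 21 + 30)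
    fun j hj => by
      refine Computes.mono (Computes.seq Computes.straight
        ((ofNat_add_computes b (j * b)).cast (congrArg Val.ofNat (by ring)))) ?_
      simp [Prog.cost]; omega
  rw [Nat.zero_mul, List.length_replicate] at h
  refine Computes.mono (Computes.seq Computes.straight h) ?_
  simp [Prog.cost, mulT]; ring_nf; omega

/-- On a list: its length. -/
def lengthP : Prog := .seq (.pair .skip (.pair .nil .nil)) (foldP (.pair .nil (.seq .tl .hd)))

theorem lengthP_computes (L : List Val) :
    Computes lengthP (Val.ofList L) (Val.ofNat L.length) (L.length * 21 + 12) := by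
  have h := Computes.fold_states (step := .pair .nil (.seq .tl .hd))
    (env := .nil) L Val.ofNat 5 fun j hj => Computes.straight
  refine Computes.mono (Computes.seq Computes.straight h) ?_
  simp [Prog.cost]; omega

/-- On `(a, b)`: the truncated difference `b - a`. -/
def subP : Prog := .seq (.pair .hd (.pair .tl .nil)) (foldP (.seq (.seq .tl .hd) .tl))

theorem ofNat_tl (a : ℕ) : (Val.ofNat a).tl = Val.ofNat (a - 1) := by
  cases a <;> rfl

theorem subP_computes (a b : ℕ) :
    Computes subP (.cons (Val.ofNat a) (Val.ofNat b)) (Val.ofNat (b - a)) (a * 21 + 12) := by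
  have h := Computes.fold_states (step := .seq (.seq .tl .hd) .tl)
    (env := .nil) (List.replicate a .nil) (fun j => Val.ofNat (b - j)) 5 fun j hj =>
      Computes.straight rfl ((ofNat_tl _).trans (by rw [Nat.sub_sub]))
  rw [List.length_replicate, Nat.sub_zero] at h
  refine Computes.mono (Computes.seq Computes.straight h) ?_
  simp [Prog.cost]; omega

theorem ofNat_eq_nil {a : ℕ} : Val.ofNat a = .nil ↔ a = 0 := by
  cases a <;> simp [Val.ofNat, Val.ofList, List.replicate_succ]

/-! ### The threshold and the selection of functionals -/

/-- The random threshold: the number of true bits among the first `R` bits of `r`, times `m`. -/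
def thresholdP : Prog :=
  .seq (.pair .hd (.pair (.pair (.seq .tl .hd) .nil) (.seq .tl .tl)))
    (.seq (foldP (.pair (.seq (.seq .tl .hd) (.seq .hd .tl))
      (.ite (.seq (.seq .tl .hd) (.seq .hd .hd))
        (.seq (.pair (.seq .tl .tl) (.seq (.seq .tl .hd) .tl)) revAppendP)
        (.seq (.seq .tl .hd) .tl)))) .tl)

def thresholdT (R m : ℕ) : ℕ := R * (m * 21 + 100) + 30

theorem thresholdP_computes (R m : ℕ) (r : List Bool) (hR : R ≤ r.length) :
    Computes thresholdP
      (.cons (Val.ofNat R) (.cons (Val.ofList (r.map Val.ofBool)) (Val.ofNat m)))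
      (Val.ofNat ((r.take R).count true * m)) (thresholdT R m) := by
  have h := Computes.fold_states (step := (.pair (.seq (.seq .tl .hd) (.seq .hd .tl))
      (.ite (.seq (.seq .tl .hd) (.seq .hd .hd))
        (.seq (.pair (.seq .tl .tl) (.seq (.seq .tl .hd) .tl)) revAppendP)
        (.seq (.seq .tl .hd) .tl))))
    (env := Val.ofNat m) (List.replicate R .nil)
    (fun j => .cons (Val.ofList ((r.map Val.ofBool).drop j))
      (Val.ofNat ((r.take j).count true * m))) (m * 21 + 80) fun j hj => by
    have hj' : j < r.length := by
      have := hj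
      rw [List.length_replicate] at this
      omega
    rw [List.drop_eq_getElem_cons (l := r.map Val.ofBool) (by simpa using hj'),
      List.take_succ_eq_append_getElem hj', List.getElem_map, List.count_append]
    refine Computes.mono (Computes.pair Computes.straight (Computes.ite (b := r[j])
      (T := m * 21 + 40) (U := 5) Computes.straight (fun h => ?_) fun h => ?_))
      (by simp [Prog.cost]; omega)
    · refine Computes.mono (Computes.seq Computes.straight ((ofNat_add_computes m _).cast
        (congrArg Val.ofNat (?_ : m + (r.take j).count true * m = _)))) ?_
      · simp [h]; ring
      · simp [Prog.cost]; omega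
    · simp only [h, List.count_singleton, Bool.false_beq]
      exact Computes.straight
  rw [List.length_replicate] at h
  simp only [List.take_zero, List.count_nil, Nat.zero_mul] at h
  refine Computes.mono (Computes.seq Computes.straight (Computes.seq h Computes.straight)) ?_
  simp [Prog.cost, thresholdT]; ring_nf; omega

/-! ### Counting violations and selecting functionals -/

/-- A point of the cube as a vector with a leading `1`. -/
def hom {d : ℕ} (x : Point d) : Vec (d + 1) := Fin.cons 1 fun i => if x i = true then 1 else 0

theorem encVec_hom {d : ℕ} (x : Point d) :
    encVec (hom x) = .cons (Val.ofBool true) (Val.ofPoint x) := by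
  have : ∀ b : Bool, encBit (if b = true then 1 else 0) = Val.ofBool b := by
    intro b; cases b <;> rfl
  simp only [encVec, hom, List.ofFn_succ, Fin.cons_zero, Fin.cons_succ, Val.ofList, Val.ofPoint,
    this]
  rfl

/-- The number of examples on which the functional `g` does not vanish. -/
def violations {d : ℕ} (g : Vec (d + 1)) (S : List (Point d × Bool)) : ℕ :=
  S.countP fun e => decide (g ⬝ᵥ hom e.1 = 1)

/-- On `(e, (a, (g, A)))`. -/
def violationsStep : Prog :=
  .ite (.seq (.pair (.seq .tl (.seq .tl .hd)) (.pair trueP (.seq .hd .hd))) dotP)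
    (.seq (.pair (.seq .tl (.seq .tl .tl)) (.seq .tl .hd)) revAppendP) (.seq .tl .hd)

/-- On `(g, (A, S))`: the number of violations, times `A`. -/
def violationsP : Prog :=
  .seq (.pair (.seq .tl .tl) (.pair .nil (.pair .hd (.seq .tl .hd)))) (foldP violationsStep)

def violationsT (d A m : ℕ) : ℕ := m * (d * 80 + A * 21 + 250) + 30

theorem violationsP_computes {d : ℕ} (g : Vec (d + 1)) (A : ℕ) (S : List (Point d × Bool)) :
    Computes violationsP
      (.cons (encVec g) (.cons (Val.ofNat A) (Val.ofList (S.map Val.ofExample))))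
      (Val.ofNat (violations g S * A)) (violationsT d A S.length) := by
  have h := Computes.fold_states (step := violationsStep)
    (env := .cons (encVec g) (Val.ofNat A)) (S.map Val.ofExample)
    (fun j => Val.ofNat (violations g (S.take j) * A)) (d * 80 + A * 21 + 220) fun j hj => by
    have hj' : j < S.length := by simpa using hj
    have hd := dotP_computes g (hom S[j].1)
    rw [encVec_hom] at hd
    rw [List.take_succ_eq_append_getElem hj', List.getElem_map]
    refine Computes.mono (Computes.ite (b := decide (g ⬝ᵥ hom S[j].1 = 1))
      (T := A * 21 + 40) (U := 3) (Computes.seq Computes.straight hd)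
      (fun h => ?_) fun h => ?_)
      (by simp [Prog.cost, trueP]; omega)
    · refine Computes.mono (Computes.seq Computes.straight ((ofNat_add_computes A _).cast
        (congrArg Val.ofNat (?_ : A + violations g (S.take j) * A = _)))) ?_
      · rw [violations, violations, List.countP_append, List.countP_singleton, if_pos h]; ring
      · simp [Prog.cost]; omega
    · rw [violations, violations, List.countP_append, List.countP_singleton, if_neg (by simp [h])]
      exact Computes.straight
  simp only [violations, List.take_zero, List.countP_nil, Nat.zero_mul, List.length_map,
    List.take_length] at h
  refine Computes.mono (Computes.seq Computes.straight h) ?_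
  simp [Prog.cost, violationsT]; ring_nf; omega

/-- The members of `L` with few violations. -/
def select {d : ℕ} (L : List (Vec (d + 1))) (θ A : ℕ) (S : List (Point d × Bool)) :
    List (Vec (d + 1)) :=
  L.foldl (fun out g => if violations g S * A ≤ θ then g :: out else out) []

theorem mem_select {d : ℕ} {L : List (Vec (d + 1))} {θ A : ℕ} {S : List (Point d × Bool)}
    {g : Vec (d + 1)} : g ∈ select L θ A S ↔ g ∈ L ∧ violations g S * A ≤ θ := by
  have : ∀ out : List (Vec (d + 1)),
      g ∈ L.foldl (fun out g => if violations g S * A ≤ θ then g :: out else out) out ↔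
        g ∈ out ∨ g ∈ L ∧ violations g S * A ≤ θ := by
    induction L with
    | nil => simp
    | cons a L ih =>
      intro out
      rw [List.foldl_cons, ih]
      by_cases h : violations a S * A ≤ θ
      · rw [if_pos h, List.mem_cons, List.mem_cons]
        constructor
        · rintro ((rfl | h') | h')
          · exact .inr ⟨.inl rfl, h⟩
          · exact .inl h'
          · exact .inr ⟨.inr h'.1, h'.2⟩
        · rintro (h' | ⟨rfl | h', h''⟩)
          · exact .inl (.inr h')
          · exact .inl (.inl rfl)
          · exact .inr ⟨h', h''⟩
      · rw [if_neg h, List.mem_cons]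
        constructor
        · rintro (h' | h')
          · exact .inl h'
          · exact .inr ⟨.inr h'.1, h'.2⟩
        · rintro (h' | ⟨rfl | h', h''⟩)
          · exact .inl h'
          · exact (h h'').elim
          · exact .inr ⟨h', h''⟩
  exact (this []).trans (by simp)

theorem length_select_le {d : ℕ} (L : List (Vec (d + 1))) (θ A : ℕ) (S : List (Point d × Bool)) :
    (select L θ A S).length ≤ L.length := by
  have : ∀ out : List (Vec (d + 1)),
      (L.foldl (fun out g => if violations g S * A ≤ θ then g :: out else out) out).length ≤
        out.length + L.length := by
    induction L with
    | nil => simp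
    | cons a L ih =>
      intro out
      rw [List.foldl_cons, List.length_cons]
      refine (ih _).trans ?_
      split_ifs
      · rw [List.length_cons]; omega
      · omega
  exact (this []).trans (by simp)

/-- On `(g, (out, (θ, (A, S))))`. -/
def selectStep : Prog :=
  .ite (.seq (.pair (.seq .tl (.seq .tl .hd))
      (.seq (.pair .hd (.seq .tl (.seq .tl .tl))) violationsP)) subP)
    (.seq .tl .hd) (.pair .hd (.seq .tl .hd))

/-- On `(L, (θ, (A, S)))`: the members of `L` with few violations. -/
def selectP : Prog := .seq (.pair .hd (.pair .nil .tl)) (foldP selectStep)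

def selectT (N d θ A m : ℕ) : ℕ := N * (violationsT d A m + θ * 21 + 60) + 20

theorem selectP_computes {d : ℕ} (L : List (Vec (d + 1))) (θ A : ℕ) (S : List (Point d × Bool)) :
    Computes selectP
      (.cons (encVecs L) (.cons (Val.ofNat θ) (.cons (Val.ofNat A)
        (Val.ofList (S.map Val.ofExample)))))
      (encVecs (select L θ A S)) (selectT L.length d θ A S.length) := by
  have h := Computes.fold (step := selectStep) (env := .cons (Val.ofNat θ) (.cons (Val.ofNat A)
        (Val.ofList (S.map Val.ofExample)))) L encVec encVecs
    (fun out g => if violations g S * A ≤ θ then g :: out else out) []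
    (violationsT d A S.length + θ * 21 + 44) fun g _ out => by
    -- The truncated difference is `nil` exactly when the functional passes the test, so the first
    -- branch is the one that rejects.
    refine Computes.mono (Computes.ite_val (T := 3) (U := 5) (Computes.seq
      (Computes.pair Computes.straight (Computes.seq Computes.straight
        (violationsP_computes g A S))) (subP_computes θ _)) (fun h => ?_) fun h => ?_)
        (by simp [Prog.cost]; omega)
    · rw [Ne, ofNat_eq_nil] at h
      rw [if_neg (by omega)]; exact Computes.straight
    · rw [ofNat_eq_nil] at h
      rw [if_pos (by omega)]; exact Computes.straight
  refine Computes.mono (Computes.seq Computes.straight h) ?_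
  simp [Prog.cost, selectT]; ring_nf; omega

/-! ### The learner -/

/-- The number of random bits that the threshold depends on. -/
def numBits (d c : ℕ) : ℕ := (4 * ((d + 1) * c)) * (4 * ((d + 1) * c))

/-- The granularity of the thresholds. -/
def scale (d a c : ℕ) : ℕ := a * (numBits d c * numBits d c)

/-- The functionals that vanish on most of the examples. -/
def smallFunctionals (d ℓ a c : ℕ) (S : List (Point d × Bool)) (i : ℕ) : List (Vec (d + 1)) :=
  select (candidates (d + 1) (ℓ + 1)) (i * S.length) (scale d a c) S

def bit (b : Bool) : ZMod 2 := if b = true then 1 else 0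

/-- A functional that is consistent with the examples. -/
def consistent {d : ℕ} (S : List (Point d × Bool)) : Vec (d + 1) :=
  (elimAll (S.map fun e => (hom e.1, bit e.2)) (0, basisList (d + 1))).1

/-- The output of the learner when `i` is the number of true bits. -/
def learn (d ℓ a c : ℕ) (S : List (Point d × Bool)) (i : ℕ) : Vec (d + 1) :=
  (elimAll ((basisList (d + 1)).map fun e => (e, 0))
    (consistent S, smallFunctionals d ℓ a c S i)).1

/-- Zero bits and unary digits are both `nil`, so in the programs the number `d + 1` doubles as the
zero vector of that length. -/
theorem encVec_zero (n : ℕ) : encVec (0 : Vec n) = Val.ofNat n := by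
  simp [encVec, encBit_zero, Val.ofNat, List.ofFn_const]

/-! ### Programs of the learner -/

/-- On `(e, ((f, K), ()))`: an elimination step for the example `e`. -/
def exampleStep : Prog :=
  .seq (.pair (.pair trueP (.seq .hd .hd)) (.pair (.seq .hd .tl) (.seq .tl .hd))) elimP

/-- On `(v, ((f, K), ()))`: an elimination step for a constraint `⟨v, ·⟩ = 0`. -/
def basisStep : Prog := .seq (.pair .hd (.pair .nil (.seq .tl .hd))) elimP

theorem exampleStep_computes {d : ℕ} (e : Point d × Bool) (s : Vec (d + 1) × List (Vec (d + 1))) :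
    Computes exampleStep (.cons (Val.ofExample e) (.cons (encState s) .nil))
      (encState (elim (hom e.1) (bit e.2) s)) (elimT (d + 1) s.2.length + 30) := by
  have h := elimP_computes (hom e.1) (bit e.2) s
  have hb : encBit (bit e.2) = Val.ofBool e.2 := by cases e.2 <;> rfl
  rw [encVec_hom, hb] at h
  refine Computes.mono (Computes.seq Computes.straight h) ?_
  simp [Prog.cost, trueP]; omega

theorem basisStep_computes {n : ℕ} (v : Vec n) (s : Vec n × List (Vec n)) :
    Computes basisStep (.cons (encVec v) (.cons (encState s) .nil))
      (encState (elim v 0 s)) (elimT n s.2.length + 30) := by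
  refine Computes.mono (Computes.seq Computes.straight (elimP_computes v 0 s)) ?_
  simp [Prog.cost]; omega

/-- On `(0, (parameters, data))`. -/
def numBitsP : Prog :=
  .seq (.seq (.pair (.pair .nil (.pair .nil (.pair .nil (.pair .nil .nil))))
      (.seq (.pair .hd (.seq (.seq .tl .hd) (.seq .tl (.seq .tl (.seq .tl .hd))))) mulP)) mulP)
    (.seq (.pair .skip .skip) mulP)

/-- On `(number of bits, (0, (parameters, data)))`. -/
def scaleP : Prog :=
  .seq (.pair (.seq (.seq .tl (.seq .tl .hd)) (.seq .tl (.seq .tl .hd)))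
    (.seq (.pair .hd .hd) mulP)) mulP

/-- On `(0, (parameters, data))`. -/
def learnCandidatesP : Prog :=
  .seq (.pair .hd (.seq (.seq .tl .hd) (.seq .tl .hd))) candidatesP

/-- On `(0, (basis, examples))`. -/
def consistentP : Prog :=
  .seq (.seq (.pair (.seq .tl .tl) (.pair (.pair .hd (.seq .tl .hd)) .nil)) (foldP exampleStep)) .hd

/-- On `(basis, (f, K))`. -/
def canonicalP : Prog :=
  .seq (.pair .hd (.pair .tl .nil)) (.seq (foldP basisStep) .hd)

/-- The program of the learner. Its local variables, the last one first, are the small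
functionals, the basis, the threshold, the granularity, the number of bits, and zero. -/
def learnP : Prog :=
  letP (.pair .nil (.seq .hd .hd)) <|
  letP numBitsP <|
  letP scaleP <|
  letP (.seq (.pair (.seq .tl .hd) (.pair (.seq .tl (.seq .tl (.seq .tl (.seq .tl .tl))))
    (.seq (.seq .tl (.seq .tl (.seq .tl (.seq .tl .hd)))) lengthP))) thresholdP) <|
  letP (.seq (.pair (.seq .tl (.seq .tl (.seq .tl .hd))) .nil) flipsP) <|
  letP (.seq (.pair (.seq (.seq .tl (.seq .tl (.seq .tl (.seq .tl .skip)))) learnCandidatesP)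
      (.pair (.seq .tl .hd) (.pair (.seq .tl (.seq .tl .hd))
        (.seq .tl (.seq .tl (.seq .tl (.seq .tl (.seq .tl (.seq .tl .hd))))))))) selectP) <|
  .seq (.pair (.seq .tl .hd) (.pair
      (.seq (.pair (.seq .tl (.seq .tl (.seq .tl (.seq .tl (.seq .tl .hd)))))
        (.pair (.seq .tl .hd)
          (.seq .tl (.seq .tl (.seq .tl (.seq .tl (.seq .tl (.seq .tl (.seq .tl .hd)))))))))
        consistentP) .hd)) canonicalP

def learnT (d ℓ a c m i : ℕ) : ℕ :=
  mulT (d + 1) c + mulT 4 ((d + 1) * c) + mulT (4 * ((d + 1) * c)) (4 * ((d + 1) * c)) +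
  mulT (numBits d c) (numBits d c) + mulT a (numBits d c * numBits d c) +
  (m * 21 + 12) + thresholdT (numBits d c) m + flipsT (d + 1) + candidatesT (d + 1) ℓ +
  selectT ((d + 2) ^ (ℓ + 1)) d (i * m) (scale d a c) m +
  (m * (elimT (d + 1) (d + 1) + 46) + 6) +
  ((d + 1) * (elimT (d + 1) ((d + 2) ^ (ℓ + 1)) + 46) + 6) + 400

theorem numBitsP_computes (d ℓ a c : ℕ) (w y : Val) :
    Computes numBitsP (.cons (Val.ofNat (d + 1)) (.cons (.cons (Val.ofNat d) (.cons (Val.ofNat ℓ)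
      (.cons (Val.ofNat a) (.cons (Val.ofNat c) w)))) y)) (Val.ofNat (numBits d c))
      (mulT (d + 1) c + mulT 4 ((d + 1) * c) +
        mulT (4 * ((d + 1) * c)) (4 * ((d + 1) * c)) + 40) := by
  have h1 := mulP_computes (d + 1) c
  have h2 := mulP_computes 4 ((d + 1) * c)
  have h3 := mulP_computes (4 * ((d + 1) * c)) (4 * ((d + 1) * c))
  refine Computes.mono (Computes.seq (Computes.seq (Computes.pair
    (Computes.straight (y := Val.ofNat 4))
      (Computes.seq (Computes.straight (y := .cons (Val.ofNat (d + 1)) (Val.ofNat c))) h1)) h2)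
      (Computes.seq (Computes.straight (y := .cons (Val.ofNat (4 * ((d + 1) * c)))
        (Val.ofNat (4 * ((d + 1) * c))))) h3)) ?_
  simp only [Prog.cost]; omega

theorem scaleP_computes (d ℓ a c : ℕ) (w x y : Val) :
    Computes scaleP (.cons (Val.ofNat (numBits d c)) (.cons x (.cons (.cons (Val.ofNat d)
      (.cons (Val.ofNat ℓ) (.cons (Val.ofNat a) w))) y))) (Val.ofNat (scale d a c))
      (mulT (numBits d c) (numBits d c) + mulT a (numBits d c * numBits d c) + 20) := by
  refine Computes.mono (Computes.seq (Computes.pair (Computes.straight (y := Val.ofNat a))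
    (Computes.seq (Computes.straight (y := .cons (Val.ofNat (numBits d c))
      (Val.ofNat (numBits d c)))) (mulP_computes _ _))) (mulP_computes a _)) ?_
  simp only [Prog.cost]; omega

theorem learnCandidatesP_computes (d ℓ : ℕ) (w y : Val) :
    Computes learnCandidatesP (.cons (Val.ofNat (d + 1)) (.cons (.cons (Val.ofNat d)
      (.cons (Val.ofNat ℓ) w)) y)) (encVecs (candidates (d + 1) (ℓ + 1)))
      (candidatesT (d + 1) ℓ + 10) := by
  have h := candidatesP_computes (d + 1) ℓ
  rw [encVec_zero] at h
  refine Computes.mono (Computes.seq (Computes.straight (y := .cons (Val.ofNat (d + 1))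
    (Val.ofNat ℓ))) h) ?_
  simp only [Prog.cost]; omega

theorem consistentP_computes {d : ℕ} (S : List (Point d × Bool)) :
    Computes consistentP (.cons (Val.ofNat (d + 1)) (.cons (encVecs (basisList (d + 1)))
      (Val.ofList (S.map Val.ofExample)))) (encVec (consistent S))
      (S.length * (elimT (d + 1) (d + 1) + 46) + 40) := by
  have h := elimAll_computes Val.ofExample (fun e => (hom e.1, bit e.2)) 30
    exampleStep_computes S (0, basisList (d + 1))
  simp only [length_basisList] at h
  refine Computes.mono (Computes.seq (Computes.seq (Computes.straight rfl ?_) h)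
    Computes.straight) ?_
  · rw [encState, encVec_zero]; rfl
  · simp only [Prog.cost, add_assoc, Nat.reduceAdd]; omega

theorem canonicalP_computes {n : ℕ} (f : Vec n) (K : List (Vec n)) :
    Computes canonicalP (.cons (encVecs (basisList n)) (.cons (encVec f) (encVecs K)))
      (encVec (elimAll ((basisList n).map fun e => (e, 0)) (f, K)).1)
      (n * (elimT n K.length + 46) + 40) := by
  have h := elimAll_computes encVec (fun e => (e, 0)) 30 basisStep_computes (basisList n) (f, K)
  simp only [length_basisList] at h
  refine Computes.mono (Computes.seq (Computes.straight rfl rfl) (Computes.seq h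
    Computes.straight)) ?_
  simp only [Prog.cost, add_assoc, Nat.reduceAdd]; omega

theorem learnP_computes (d ℓ a c b : ℕ) {M R : ℕ} (S : Fin M → Point d × Bool) (r : Fin R → Bool)
    (hR : numBits d c ≤ R) :
    Computes learnP (learnerInput [d, ℓ, a, c, b] S r)
      (encVec (learn d ℓ a c (List.ofFn S) (((List.ofFn r).take (numBits d c)).count true)))
      (learnT d ℓ a c M (((List.ofFn r).take (numBits d c)).count true)) := by
  have h6 := lengthP_computes (List.ofFn fun m => Val.ofExample (S m))
  rw [List.length_ofFn] at h6
  have h7 := thresholdP_computes (numBits d c) M (List.ofFn r) (by simpa using hR)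
  have h8 := flipsP_computes (0 : Vec (d + 1)) []
  rw [encVec_zero] at h8
  generalize hi : ((List.ofFn r).take (numBits d c)).count true = i at h7 ⊢
  have h10 := selectP_computes (candidates (d + 1) (ℓ + 1)) (i * M) (scale d a c) (List.ofFn S)
  have h11 := consistentP_computes (List.ofFn S)
  have h12 := canonicalP_computes (consistent (List.ofFn S))
      (smallFunctionals d ℓ a c (List.ofFn S) i)
  have hSel : select (candidates (d + 1) (ℓ + 1)) (i * M) (scale d a c) (List.ofFn S) =
      smallFunctionals d ℓ a c (List.ofFn S) i := by
    simp [smallFunctionals]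
  have hlen : (smallFunctionals d ℓ a c (List.ofFn S) i).length ≤ (d + 2) ^ (ℓ + 1) :=
    (length_select_le _ _ _ _).trans (length_candidates _ _).le
  have hmap : (List.ofFn S).map Val.ofExample = List.ofFn fun m => Val.ofExample (S m) :=
    List.map_ofFn
  have hmapr : (List.ofFn r).map Val.ofBool = List.ofFn fun m => Val.ofBool (r m) :=
    List.map_ofFn
  rw [hmap] at h10 h11
  rw [hmapr] at h7
  rw [hSel] at h10
  rw [← learn] at h12
  change Computes flipsP _ (encVecs (basisList (d + 1))) _ at h8
  simp only [List.length_ofFn, length_candidates] at h10 h11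
  unfold learnerInput learnP
  generalize (Val.ofList (List.ofFn fun m => Val.ofExample (S m))) = vS at *
  -- The encodings become opaque, so that `rfl` only has to follow the pairs.
  generalize (Val.ofList (List.ofFn fun m => Val.ofBool (r m))) = vr at *
  generalize encVecs (smallFunctionals d ℓ a c (List.ofFn S) i) = vG at *
  generalize encVecs (basisList (d + 1)) = vB at *
  generalize encVec (consistent (List.ofFn S)) = vf at *
  have h3 := scaleP_computes d ℓ a c (.cons (Val.ofNat c) (.cons (Val.ofNat b) .nil))
    (Val.ofNat (d + 1)) (.cons vS vr)
  apply Computes.mono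
  case h =>
    apply Computes.letP (Computes.straight (y := Val.ofNat (d + 1)))
    apply Computes.letP (numBitsP_computes d ℓ a c _ _)
    apply Computes.letP h3
    apply Computes.letP (Computes.seq (Computes.pair
      (Computes.straight (y := Val.ofNat (numBits d c))) (Computes.pair
        (Computes.straight (y := vr)) (Computes.seq (Computes.straight (y := vS)) h6))) h7)
    apply Computes.letP (Computes.seq (Computes.straight
      (y := .cons (Val.ofNat (d + 1)) .nil)) h8)
    apply Computes.letP (Computes.seq (Computes.pair (Computes.seq
      (Computes.straight rfl rfl) (learnCandidatesP_computes d ℓ _ _))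
      (Computes.straight
        (y := .cons (Val.ofNat (i * M)) (.cons (Val.ofNat (scale d a c)) vS)))) h10)
    exact Computes.seq (Computes.pair (Computes.straight (y := vB)) (Computes.pair
      (Computes.seq (Computes.straight (y := .cons (Val.ofNat (d + 1)) (.cons vB vS))) h11)
      (Computes.straight (y := vG)))) h12
  clear h3 h6 h7 h8 h10 h11 h12
  -- The number of selected functionals depends on the sample; the number of all candidates bounds
  -- it.
  have hT : (d + 1) * (elimT (d + 1) (smallFunctionals d ℓ a c (List.ofFn S) i).length + 46) ≤
      (d + 1) * (elimT (d + 1) ((d + 2) ^ (ℓ + 1)) + 46) :=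
    Nat.mul_le_mul_left _ (Nat.add_le_add_right (Nat.mul_le_mul_right _ (by omega)) _)
  simp only [Prog.cost, learnT]
  generalize (d + 1) * (elimT (d + 1) (smallFunctionals d ℓ a c (List.ofFn S) i).length + 46) = t1
    at *
  generalize (d + 1) * (elimT (d + 1) ((d + 2) ^ (ℓ + 1)) + 46) = t2 at *
  generalize mulT (d + 1) c = t3
  generalize mulT 4 ((d + 1) * c) = t4
  generalize mulT (4 * ((d + 1) * c)) (4 * ((d + 1) * c)) = t5
  rw [show (d + 1 + 1) ^ (ℓ + 1) = (d + 2) ^ (ℓ + 1) from rfl]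
  generalize M * (elimT (d + 1) (d + 1) + 46) = t6
  generalize mulT a (numBits d c * numBits d c) = t7
  omega

/-- The program that evaluates a hypothesis. -/
def evalP : Prog := .seq (.pair .hd (.pair trueP .tl)) dotP

theorem evalP_computes {d : ℕ} (v : Vec (d + 1)) (x : Point d) :
    Computes evalP (.cons (encVec v) (Val.ofPoint x)) (Val.ofBool (decide (v ⬝ᵥ hom x = 1)))
      (d * 80 + 140) := by
  have h := dotP_computes v (hom x)
  rw [encVec_hom] at h
  refine Computes.mono (Computes.seq Computes.straight h) ?_
  simp [Prog.cost, trueP]; omega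

/-! ### Decision trees and parities -/

/-- Query every coordinate. It follows that the infimum in `dtComplexity` is attained and is not the
default value `0` of an empty set. -/
theorem exists_decTree {d : ℕ} (F : Point d → ℝ) : ∃ T : DecTree d, ∀ x, T.eval x = F x := by
  have key : ∀ (l : List (Fin d)) (y : Point d),
      ∃ T : DecTree d, ∀ x, (∀ i, i ∉ l → x i = y i) → T.eval x = F x := by
    intro l
    induction l with
    | nil => exact fun y => ⟨.leaf (F y), fun x hx => by
        rw [show x = y from funext fun i => hx i (by simp)]; rfl⟩
    | cons i l ih =>
      intro y
      obtain ⟨T₀, h₀⟩ := ih (Function.update y i false)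
      obtain ⟨T₁, h₁⟩ := ih (Function.update y i true)
      refine ⟨.node i T₀ T₁, fun x hx => ?_⟩
      have hup : ∀ b, x i = b → ∀ j, j ∉ l → x j = Function.update y i b j := by
        intro b hb j hj
        by_cases hji : j = i
        · subst hji; simp [hb]
        · rw [Function.update_of_ne hji]
          exact hx j (by simp [hji, hj])
      cases hxi : x i
      · simpa [DecTree.eval, hxi] using h₀ x (hup _ hxi)
      · simpa [DecTree.eval, hxi] using h₁ x (hup _ hxi)
  obtain ⟨T, hT⟩ := key (List.finRange d) fun _ => false
  exact ⟨T, fun x => hT x fun i hi => (hi (List.mem_finRange i)).elim⟩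

theorem exists_decTree_of_dtComplexity_le {d ℓ : ℕ} {D : Measure (Point d)}
    (h : dtComplexity D ≤ ℓ) : ∃ T : DecTree d, T.depth ≤ ℓ ∧ ∀ x, D.real {x} = T.eval x := by
  obtain ⟨T, hT⟩ := exists_decTree fun x => D.real {x}
  have hne : {k | 1 ≤ k ∧ ∃ T : DecTree d, T.depth ≤ k ∧ ∀ x, D.real {x} = T.eval x}.Nonempty :=
    ⟨max 1 T.depth, le_max_left _ _, T, le_max_right _ _, fun x => (hT x).symm⟩
  obtain ⟨-, T', h1, h2⟩ := Nat.sInf_mem hne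
  exact ⟨T', h1.trans h, h2⟩

/-! ### Fourier analysis of decision trees -/

/-- The additive character of the field with two elements. -/
def sign (c : ZMod 2) : ℝ := if c = 1 then -1 else 1

theorem sign_add (a b : ZMod 2) : sign (a + b) = sign a * sign b := by
  have h : (1 : ZMod 2) + 1 ≠ 1 := by decide
  rcases zmod_two_cases a with rfl | rfl <;> rcases zmod_two_cases b with rfl | rfl <;>
    simp [sign]

/-- The variables that a functional depends on. -/
def vars {d : ℕ} (g : Vec (d + 1)) : Finset (Fin d) := Finset.univ.filter fun i => g i.succ ≠ 0

/-- Flipping the variable `i` permutes the cube and reverses the sign of the character. -/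
theorem sum_sign_eq_zero {d : ℕ} {g : Vec (d + 1)} {i : Fin d} (hi : i ∈ vars g) :
    ∑ x : Point d, sign (g ⬝ᵥ hom x) = 0 := by
  have hg : g i.succ = 1 := (zmod_two_cases _).resolve_left (by simpa [vars] using hi)
  let e : Point d ≃ Point d := Function.Involutive.toPerm
    (fun x => Function.update x i (!x i)) fun x => by simp
  have he : ∀ x, e x = Function.update x i (!x i) := fun x => rfl
  have hflip : ∀ x, hom (e x) = hom x + Pi.single i.succ 1 := by
    intro x
    ext j
    refine Fin.cases ?_ (fun j => ?_) j
    · simp [hom, (Fin.succ_ne_zero i).symm]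
    · by_cases hji : j = i
      · subst hji
        have : (1 : ZMod 2) + 1 = 0 := by decide
        cases hx : x j <;> simp [hom, he, hx, this]
      · simp [hom, he, hji]
  have h := Equiv.sum_comp e fun x => sign (g ⬝ᵥ hom x)
  simp only [hflip, dotProduct_add, sign_add, dotProduct_single, hg] at h
  rw [← Finset.sum_mul] at h
  simp [sign] at h
  simp [sign]
  linarith

/-- A query of `x i` multiplies the subtrees by `(1 ± (-1) ^ x i) / 2`, which at worst toggles
coordinate `i` of the functional. Each level of the tree thus costs at most one variable, and at a
leaf one is still left. -/
theorem sum_decTree_sign_eq_zero {d : ℕ} (T : DecTree d) (g : Vec (d + 1))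
    (h : T.depth < (vars g).card) : ∑ x, T.eval x * sign (g ⬝ᵥ hom x) = 0 := by
  induction T generalizing g with
  | leaf v =>
    obtain ⟨i, hi⟩ := Finset.card_pos.1 (Nat.zero_lt_of_lt h)
    simp only [DecTree.eval, ← Finset.mul_sum, sum_sign_eq_zero hi, mul_zero]
  | node i L R ihL ihR =>
    simp only [DecTree.depth] at h
    have hc : (vars g).card ≤ (vars (g + Pi.single i.succ 1)).card + 1 := by
      have hsub : (vars g).erase i ⊆ vars (g + Pi.single i.succ 1) := by
        intro j hj
        simp only [Finset.mem_erase, vars, Finset.mem_filter, Finset.mem_univ, true_and] at hj ⊢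
        rw [Pi.add_apply, Pi.single_eq_of_ne (fun h => hj.1 (Fin.succ_injective _ h)), add_zero]
        exact hj.2
      have := Finset.card_le_card hsub
      have := Finset.pred_card_le_card_erase (s := vars g) (a := i)
      omega
    have e : ∀ x : Point d, (DecTree.node i L R).eval x * sign (g ⬝ᵥ hom x) =
        (L.eval x * sign (g ⬝ᵥ hom x) + L.eval x * sign ((g + Pi.single i.succ 1) ⬝ᵥ hom x) +
        R.eval x * sign (g ⬝ᵥ hom x) - R.eval x * sign ((g + Pi.single i.succ 1) ⬝ᵥ hom x)) / 2 := by
      intro x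
      rw [add_dotProduct, sign_add, single_dotProduct, one_mul, DecTree.eval]
      cases hx : x i <;> simp [hom, hx, sign]
    simp only [e]
    rw [← Finset.sum_div, Finset.sum_sub_distrib, Finset.sum_add_distrib, Finset.sum_add_distrib,
      ihL _ (by omega), ihL _ (by omega), ihR _ (by omega), ihR _ (by omega)]
    simp

/-- The probability that a functional does not vanish. -/
noncomputable def mass {d : ℕ} (D : Measure (Point d)) (g : Vec (d + 1)) : ℝ :=
  D.real {x | g ⬝ᵥ hom x = 1}

/-- The character sum weighted by the mass function is `1 - 2 * mass D g`. -/
theorem mass_eq_half {d ℓ : ℕ} {D : Measure (Point d)} [IsProbabilityMeasure D]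
    (hD : dtComplexity D ≤ ℓ) {g : Vec (d + 1)} (hg : ℓ < (vars g).card) : mass D g = 1 / 2 := by
  obtain ⟨T, hT, hTD⟩ := exists_decTree_of_dtComplexity_le hD
  have h := sum_decTree_sign_eq_zero T g (by omega)
  simp only [← hTD] at h
  have h1 : ∑ x, D.real {x} = 1 := by
    rw [sum_measureReal_singleton]; simp
  have h2 : mass D g = ∑ x, if g ⬝ᵥ hom x = 1 then D.real {x} else 0 := by
    rw [← Finset.sum_filter, sum_measureReal_singleton, mass]
    simp
  have h3 : ∑ x, D.real {x} * sign (g ⬝ᵥ hom x) = 1 - 2 * mass D g := by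
    rw [← h1, h2, Finset.mul_sum, ← Finset.sum_sub_distrib]
    refine Finset.sum_congr rfl fun x _ => ?_
    simp only [sign]
    split_ifs <;> ring
  linarith

/-- The additional unit of weight is for the constant coordinate `0`. -/
theorem mem_candidates_of_card_vars_le {d ℓ : ℕ} {g : Vec (d + 1)} (hg : (vars g).card ≤ ℓ) :
    g ∈ candidates (d + 1) (ℓ + 1) := by
  refine mem_candidates ?_
  have : (Finset.univ.filter fun i => g i ≠ 0) ⊆ insert 0 ((vars g).map (Fin.succEmb d)) := by
    intro i
    refine Fin.cases (fun _ => by simp) (fun i hi => ?_) i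
    simpa [vars] using hi
  refine (Finset.card_le_card this).trans ((Finset.card_insert_le _ _).trans ?_)
  rw [Finset.card_map]; omega

/-! ### Chains of subspaces -/

/-- Each strict inclusion raises the dimension, and the interleaving `hi i ≤ lo (i + 1)` preserves
what was gained. -/
theorem card_jumps_le {V : Type*} [AddCommGroup V] [Module (ZMod 2) V] [FiniteDimensional (ZMod 2) V]
    (lo hi : ℕ → Submodule (ZMod 2) V) (h₁ : ∀ i, lo i ≤ hi i) (h₂ : ∀ i, hi i ≤ lo (i + 1))
    (N : ℕ) [DecidablePred fun i => lo i ≠ hi i] :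
    ((Finset.range N).filter fun i => lo i ≠ hi i).card ≤ Module.finrank (ZMod 2) V := by
  have key : ((Finset.range N).filter fun i => lo i ≠ hi i).card ≤
      Module.finrank (ZMod 2) (lo N) := by
    induction N with
    | zero => simp
    | succ N ih =>
      have h3 := Submodule.finrank_mono (h₂ N)
      rw [Finset.range_add_one, Finset.filter_insert]
      split_ifs with h
      · rw [Finset.card_insert_of_notMem (by simp)]
        have := Submodule.finrank_lt_finrank_of_lt (lt_of_le_of_ne (h₁ N) h)
        omega
      · have := Submodule.finrank_mono (h₁ N)
        omega
  exact key.trans (Submodule.finrank_le _)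

/-! ### The number of true bits of a random string -/

theorem card_count_take {R m : ℕ} (hm : m ≤ R) (i : ℕ) :
    (Finset.univ.filter fun r : Fin R → Bool => ((List.ofFn r).take m).count true = i).card =
      m.choose i * 2 ^ (R - m) := by
  induction m generalizing R i with
  | zero => cases i <;> simp [eq_comm]
  | succ m ih =>
    obtain ⟨R, rfl⟩ : ∃ R', R = R' + 1 := ⟨R - 1, by omega⟩
    simp only [Finset.card_filter] at ih ⊢
    rw [← Equiv.sum_comp (Fin.consEquiv fun _ => Bool), Fintype.sum_prod_type, Fintype.sum_bool]
    simp only [Fin.consEquiv_apply, List.ofFn_succ, Fin.cons_zero, Fin.cons_succ,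
      List.take_succ_cons, List.count_cons, beq_self_eq_true, if_true]
    have h0 := ih (by omega : m ≤ R)
    rw [show R + 1 - (m + 1) = R - m by omega]
    cases i with
    | zero => simp [h0]
    | succ i =>
      simp only [Nat.add_right_cancel_iff, h0, Nat.choose_succ_succ]
      simp [h0]
      ring

/-- The factor `2 n + 1` carries the induction because `(2 n + 1) (2 n + 3) ≤ (2 n + 2) ^ 2`. -/
theorem centralBinom_sq_mul_le (n : ℕ) : n.centralBinom ^ 2 * (2 * n + 1) ≤ 16 ^ n := by
  induction n with
  | zero => simp
  | succ n ih =>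
    have h := Nat.succ_mul_centralBinom_succ n
    refine le_of_mul_le_mul_left ?_ (pow_pos n.succ_pos 2)
    calc (n + 1) ^ 2 * ((n + 1).centralBinom ^ 2 * (2 * (n + 1) + 1))
        = ((n + 1) * (n + 1).centralBinom) ^ 2 * (2 * n + 3) := by ring
      _ = (4 * ((2 * n + 1) * (2 * n + 3))) * (n.centralBinom ^ 2 * (2 * n + 1)) := by
          rw [h]; ring
      _ ≤ (4 * (4 * (n + 1) ^ 2)) * 16 ^ n := Nat.mul_le_mul (by nlinarith) ih
      _ = (n + 1) ^ 2 * 16 ^ (n + 1) := by ring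

instance (R : ℕ) : IsProbabilityMeasure (coinLaw R) := by
  unfold coinLaw; infer_instance

theorem coinLaw_real (R : ℕ) (s : Set (Fin R → Bool)) [DecidablePred (· ∈ s)] :
    (coinLaw R).real s = (Finset.univ.filter (· ∈ s)).card / 2 ^ R := by
  have h1 : ∀ r, (coinLaw R).real {r} = 1 / 2 ^ R := by
    intro r
    rw [measureReal_def, coinLaw, Measure.pi_singleton]
    simp
  have h2 : (coinLaw R).real s = ∑ r ∈ Finset.univ.filter (· ∈ s), (coinLaw R).real {r} := by
    rw [sum_measureReal_singleton]; simp
  rw [h2, Finset.sum_congr rfl fun r _ => h1 r]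
  simp [div_eq_mul_inv]

/-- Every value of the number of true bits among `4 k²` bits has probability at most `1 / (2 k)`. -/
theorem coinLaw_count_le {R k : ℕ} (hk : 0 < k) (hR : 4 * k ^ 2 ≤ R) (i : ℕ) :
    (coinLaw R).real {r | ((List.ofFn r).take (4 * k ^ 2)).count true = i} ≤ 1 / (2 * k) := by
  classical
  rw [coinLaw_real]
  simp only [Set.mem_ofPred_eq]
  rw [card_count_take hR]
  have h1 : (4 * k ^ 2).choose i ≤ (2 * k ^ 2).centralBinom := by
    have := Nat.choose_le_centralBinom i (2 * k ^ 2)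
    rwa [show 2 * (2 * k ^ 2) = 4 * k ^ 2 by ring] at this
  have h2 := centralBinom_sq_mul_le (2 * k ^ 2)
  -- With `n = 2 k ^ 2`, the factor `2 n` is the square of `2 k`.
  have h3 : (2 * k ^ 2).centralBinom * (2 * k) ≤ 4 ^ (2 * k ^ 2) := by
    refine (Nat.pow_le_pow_iff_left two_ne_zero).1 ?_
    calc ((2 * k ^ 2).centralBinom * (2 * k)) ^ 2
        = (2 * k ^ 2).centralBinom ^ 2 * (2 * (2 * k ^ 2)) := by ring
      _ ≤ (2 * k ^ 2).centralBinom ^ 2 * (2 * (2 * k ^ 2) + 1) :=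
          Nat.mul_le_mul_left _ (Nat.le_succ _)
      _ ≤ 16 ^ (2 * k ^ 2) := h2
      _ = (4 ^ (2 * k ^ 2)) ^ 2 := by rw [show 16 = 4 ^ 2 by norm_num, ← pow_mul, ← pow_mul, mul_comm]
  have h4 : (4 * k ^ 2).choose i * (2 * k) ≤ 2 ^ (4 * k ^ 2) := by
    refine (Nat.mul_le_mul_right _ h1).trans (h3.trans (le_of_eq ?_))
    rw [show 4 * k ^ 2 = 2 * (2 * k ^ 2) by ring, pow_mul 2 2,
      show 2 ^ 2 = 4 by norm_num]
  have h5 : (2 : ℝ) ^ R = 2 ^ (4 * k ^ 2) * 2 ^ (R - 4 * k ^ 2) := by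
    rw [← pow_add]; congr 1; omega
  rw [h5, Nat.cast_mul, Nat.cast_pow, Nat.cast_ofNat, mul_div_mul_right _ _ (by positivity),
    div_le_div_iff₀ (by positivity) (by positivity), one_mul]
  exact_mod_cast h4

/-! ### Concentration of empirical frequencies -/

/-- Chebyshev's inequality, where an indicator has variance at most `1 / 4`. Its polynomial rate is
enough, as the sample may be polynomial in `1 / β`. -/
theorem pi_real_deviation_le {Ω : Type*} [MeasurableSpace Ω] [DiscreteMeasurableSpace Ω] [Finite Ω]
    (ν : Measure Ω) [IsProbabilityMeasure ν] (B : Set Ω) [DecidablePred (· ∈ B)] {M : ℕ}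
    (hM : 0 < M) {ε : ℝ} (hε : 0 < ε) :
    (Measure.pi fun _ : Fin M => ν).real
      {S | ε * M ≤ |(∑ m, if S m ∈ B then (1 : ℝ) else 0) - M * ν.real B|} ≤
      1 / (4 * M * ε ^ 2) := by
  have hM' : (0 : ℝ) < M := by exact_mod_cast hM
  let X : Ω → ℝ := fun ω => if ω ∈ B then 1 else 0
  have hX : X = B.indicator 1 := by
    ext ω; simp [X, Set.indicator_apply]
  have hE : ∫ ω, X ω ∂ν = ν.real B := by
    rw [hX, integral_indicator_one (MeasurableSet.of_discrete)]
  let Y : (Fin M → Ω) → ℝ := ∑ m : Fin M, fun S : Fin M → Ω => X (S m)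
  have hY : ∀ S, Y S = ∑ m, if S m ∈ B then (1 : ℝ) else 0 := by
    intro S; simp [Y, X]
  have hEY : ∫ S, Y S ∂(Measure.pi fun _ : Fin M => ν) = M * ν.real B := by
    simp only [Y, Finset.sum_apply]
    rw [integral_finsetSum _ fun m _ => Integrable.of_finite]
    have : ∀ m : Fin M, ∫ S, X (S m) ∂(Measure.pi fun _ : Fin M => ν) = ν.real B := by
      intro m
      rw [← hE]
      exact integral_comp_eval (μ := fun _ : Fin M => ν) (i := m) (f := X)
        AEStronglyMeasurable.of_discrete
    simp [this]
  have hV : variance Y (Measure.pi fun _ : Fin M => ν) ≤ M / 4 := by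
    have h1 : variance X ν ≤ 1 / 4 := by
      refine (variance_le_sq_of_bounded (a := 0) (b := 1) (ae_of_all _ fun ω => ?_)
        AEMeasurable.of_discrete).trans (by norm_num)
      simp only [X]; split_ifs <;> simp
    have h2 := variance_sum_pi (μ := fun _ : Fin M => ν) (X := fun _ => X) fun _ => MemLp.of_discrete
    rw [h2]
    calc ∑ _i : Fin M, variance X ν ≤ ∑ _i : Fin M, (1 / 4 : ℝ) := Finset.sum_le_sum fun _ _ => h1
      _ = M / 4 := by simp [div_eq_mul_inv]
  have h := meas_ge_le_variance_div_sq (μ := Measure.pi fun _ : Fin M => ν) (X := Y)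
    MemLp.of_discrete (mul_pos hε hM')
  rw [hEY] at h
  simp only [hY] at h
  refine (ENNReal.toReal_le_of_le_ofReal (by positivity [variance_nonneg Y (Measure.pi fun _ : Fin M => ν)]) h).trans ?_
  rw [div_le_div_iff₀ (by positivity) (by positivity)]
  nlinarith [mul_le_mul_of_nonneg_right hV (by positivity : (0 : ℝ) ≤ 4 * M * ε ^ 2)]

theorem violations_ofFn {d M : ℕ} (g : Vec (d + 1)) (S : Fin M → Point d × Bool) :
    (violations g (List.ofFn S) : ℝ) = ∑ m, if g ⬝ᵥ hom (S m).1 = 1 then (1 : ℝ) else 0 := by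
  induction M with
  | zero => simp [violations]
  | succ M ih =>
    have := ih fun m => S m.succ
    rw [violations] at this ⊢
    rw [Fin.sum_univ_succ, List.ofFn_succ, List.countP_cons, Nat.cast_add, this, add_comm]
    simp

/-! ### Representative samples -/

/-- The sample is labelled by the functional `f`, the empirical masses of the candidates are
accurate, and no functional of mass `1 / 2` vanishes on the whole sample. -/
structure Representative {d : ℕ} (D : Measure (Point d)) (ℓ A : ℕ) (f : Vec (d + 1))
    (S : List (Point d × Bool)) : Prop where
  label : ∀ e ∈ S, f ⬝ᵥ hom e.1 = bit e.2
  accurate : ∀ g ∈ candidates (d + 1) (ℓ + 1),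
    |(violations g S : ℝ) - S.length * mass D g| * (4 * A) ≤ S.length
  cover : ∀ g : Vec (d + 1), mass D g = 1 / 2 → ∃ e ∈ S, g ⬝ᵥ hom e.1 = 1

/-! ### Spans of functionals of small mass -/

/-- The span of the candidates of mass at most `θ`. -/
def level {d : ℕ} (D : Measure (Point d)) (ℓ : ℕ) (θ : ℝ) : Submodule (ZMod 2) (Vec (d + 1)) :=
  Submodule.span (ZMod 2) {g | g ∈ candidates (d + 1) (ℓ + 1) ∧ mass D g ≤ θ}

theorem level_mono {d : ℕ} (D : Measure (Point d)) (ℓ : ℕ) {θ₁ θ₂ : ℝ} (h : θ₁ ≤ θ₂) :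
    level D ℓ θ₁ ≤ level D ℓ θ₂ :=
  Submodule.span_mono fun _ hg => ⟨hg.1, hg.2.trans h⟩

theorem mem_smallFunctionals {d ℓ a c i : ℕ} {S : List (Point d × Bool)} {g : Vec (d + 1)} :
    g ∈ smallFunctionals d ℓ a c S i ↔
      g ∈ candidates (d + 1) (ℓ + 1) ∧ violations g S * scale d a c ≤ i * S.length :=
  mem_select

namespace Representative

variable {d ℓ a c : ℕ} {D : Measure (Point d)} {f : Vec (d + 1)} {S : List (Point d × Bool)}

/-- The difference vanishes on the sample, so `cover` excludes mass `1 / 2` and `mass_eq_half`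
leaves at most `ℓ` variables. It is thus a candidate without violations, selected at every
threshold. -/
theorem consistent_sub_mem [IsProbabilityMeasure D] (h : Representative D ℓ (scale d a c) f S)
    (hD : dtComplexity D ≤ ℓ) (i : ℕ) :
    consistent S - f ∈ listSpan (smallFunctionals d ℓ a c S i) := by
  have hz : ∀ e ∈ S, (consistent S - f) ⬝ᵥ hom e.1 = 0 := by
    have := elimAll_sub_dotProduct (cs := S.map fun e => (hom e.1, bit e.2))
      (s := (0, basisList (d + 1))) (span_basisList _) (f := f) fun c hc => by
        obtain ⟨e, he, rfl⟩ := List.mem_map.1 hc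
        exact h.label e he
    intro e he
    exact this _ (List.mem_map_of_mem he)
  have hm : mass D (consistent S - f) ≠ 1 / 2 := by
    intro hm
    obtain ⟨e, he, h1⟩ := h.cover _ hm
    rw [hz e he] at h1
    exact zero_ne_one h1
  have hv : violations (consistent S - f) S = 0 := by
    rw [violations, List.countP_eq_zero]
    intro e he
    simp [hz e he]
  refine Submodule.subset_span (mem_smallFunctionals.2 ⟨mem_candidates_of_card_vars_le ?_, ?_⟩)
  · by_contra hlt
    exact hm (mass_eq_half hD (not_le.1 hlt))
  · simp [hv]

/-- Only the coset matters, so the solution found may be replaced by the target; the output depends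
on the sample through the span alone. -/
theorem learn_eq [IsProbabilityMeasure D] (h : Representative D ℓ (scale d a c) f S)
    (hD : dtComplexity D ≤ ℓ) (i : ℕ) :
    learn d ℓ a c S i = (elimAll ((basisList (d + 1)).map fun e => (e, 0))
      (f, smallFunctionals d ℓ a c S i)).1 := by
  have hs : SameSpace (consistent S, smallFunctionals d ℓ a c S i)
      (f, smallFunctionals d ℓ a c S i) := ⟨rfl, h.consistent_sub_mem hD i⟩
  rw [learn]
  refine hs.elimAll_fst_eq fun u hu => ?_
  exact eq_zero_of_orthogonal_basisList fun v hv => hu _ (List.mem_map_of_mem hv)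

theorem learn_sub_mem [IsProbabilityMeasure D] (h : Representative D ℓ (scale d a c) f S)
    (hD : dtComplexity D ≤ ℓ) (i : ℕ) :
    learn d ℓ a c S i - f ∈ listSpan (smallFunctionals d ℓ a c S i) := by
  rw [h.learn_eq hD]
  exact elimAll_fst_sub_mem _ (f, smallFunctionals d ℓ a c S i)

/-- The estimates are accurate to a quarter of the granularity `1 / scale d a c`, so the empirical
threshold `i` is enclosed by the true ones `i ± 1 / 4` in this unit. The windows for different `i`
are disjoint. -/
theorem span_le_level (h : Representative D ℓ (scale d a c) f S) (hS : 0 < S.length)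
    (hA : 0 < scale d a c) (i : ℕ) :
    listSpan (smallFunctionals d ℓ a c S i) ≤ level D ℓ ((4 * i + 1) / (4 * scale d a c)) := by
  rw [listSpan, level]
  refine Submodule.span_mono fun g hg => ?_
  obtain ⟨h1, h2⟩ := mem_smallFunctionals.1 (Set.mem_ofPred_eq ▸ hg)
  refine ⟨h1, ?_⟩
  have h3 := h.accurate g h1
  have h2' : (violations g S : ℝ) * scale d a c ≤ i * S.length := by exact_mod_cast h2
  have hS' : (0 : ℝ) < S.length := by exact_mod_cast hS
  have hA' : (0 : ℝ) < scale d a c := by exact_mod_cast hA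
  have h4 := neg_abs_le ((violations g S : ℝ) - S.length * mass D g)
  rw [le_div_iff₀ (by positivity)]
  refine le_of_mul_le_mul_left ?_ hS'
  nlinarith

theorem level_le_span (h : Representative D ℓ (scale d a c) f S) (hS : 0 < S.length)
    (hA : 0 < scale d a c) (i : ℕ) :
    level D ℓ ((4 * i - 1) / (4 * scale d a c)) ≤ listSpan (smallFunctionals d ℓ a c S i) := by
  rw [listSpan, level]
  refine Submodule.span_mono fun g hg => ?_
  rw [Set.mem_ofPred_eq] at hg ⊢
  refine mem_smallFunctionals.2 ⟨hg.1, ?_⟩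
  have h3 := h.accurate g hg.1
  have h2 := hg.2
  have hS' : (0 : ℝ) < S.length := by exact_mod_cast hS
  have hA' : (0 : ℝ) < scale d a c := by exact_mod_cast hA
  rw [le_div_iff₀ (by positivity)] at h2
  have h4 := le_abs_self ((violations g S : ℝ) - S.length * mass D g)
  have h5 : (violations g S : ℝ) * scale d a c ≤ i * S.length := by nlinarith
  exact_mod_cast h5

end Representative

/-- Elements of a span of functionals of small mass have small mass. -/
theorem mass_le_of_mem_level {d ℓ : ℕ} {D : Measure (Point d)} [IsProbabilityMeasure D] {θ : ℝ}
    (hθ : 0 ≤ θ) {w : Vec (d + 1)} (hw : w ∈ level D ℓ θ) : mass D w ≤ (d + 1) * θ := by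
  -- A basis chosen among the spanning functionals keeps the union bound at `d + 1` terms, however
  -- many candidates there are.
  obtain ⟨b, hb, hspan, hli⟩ := exists_linearIndependent (ZMod 2)
    {g : Vec (d + 1) | g ∈ candidates (d + 1) (ℓ + 1) ∧ mass D g ≤ θ}
  have hfin : b.Finite := Set.toFinite b
  lift b to Finset (Vec (d + 1)) using hfin
  have hcard : b.card ≤ d + 1 := by
    have := hli.fintype_card_le_finrank
    simpa using this
  have hsub : {x : Point d | w ⬝ᵥ hom x = 1} ⊆ ⋃ g ∈ b, {x | g ⬝ᵥ hom x = 1} := by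
    intro x hx
    by_contra hcon
    simp only [Set.mem_iUnion, Set.mem_ofPred_eq, not_exists] at hcon
    have hw' : w ∈ listSpan b.toList := by
      rw [level, ← hspan] at hw
      simpa [listSpan] using hw
    have := dotProduct_eq_zero_of_mem_span (z := hom x) (fun u hu =>
      (zmod_two_cases _).resolve_right (hcon u (by simpa using hu))) hw'
    rw [Set.mem_ofPred_eq, this] at hx
    exact zero_ne_one hx
  calc mass D w ≤ D.real (⋃ g ∈ b, {x | g ⬝ᵥ hom x = 1}) :=
      measureReal_mono hsub (measure_ne_top _ _)
    _ ≤ ∑ g ∈ b, mass D g := measureReal_biUnion_finset_le _ _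
    _ ≤ ∑ _g ∈ b, θ := Finset.sum_le_sum fun g hg => (hb hg).2
    _ = b.card * θ := by simp
    _ ≤ (d + 1) * θ := mul_le_mul_of_nonneg_right (by exact_mod_cast hcard) hθ

/-- A large random sample is representative. -/
theorem pi_real_not_representative_le {d ℓ A b M : ℕ} {D : Measure (Point d)}
    [IsProbabilityMeasure D] {t : Point d → Bool} {f : Vec (d + 1)}
    (hf : ∀ x, f ⬝ᵥ hom x = bit (t x)) (hA : 0 < A) (hb : 0 < b)
    (hM₁ : 8 * (d + 2) ^ (ℓ + 1) * A ^ 2 * b ≤ M) (hM₂ : d + 1 + 2 * b ≤ M) :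
    (Measure.pi fun _ : Fin M => D.map fun x => (x, t x)).real
      {S | ¬ Representative D ℓ A f (List.ofFn S)} ≤ 1 / b := by
  classical
  set ν : Measure (Point d × Bool) := D.map fun x => (x, t x) with hν
  have hmeas : Measurable fun x : Point d => (x, t x) := Measurable.of_discrete
  have : IsProbabilityMeasure ν := Measure.isProbabilityMeasure_map hmeas.aemeasurable
  have hmap : ∀ B : Set (Point d × Bool), ν.real B = D.real {x | (x, t x) ∈ B} := fun B =>
    map_measureReal_apply hmeas MeasurableSet.of_discrete
  have hmass : ∀ g : Vec (d + 1), ν.real {e | g ⬝ᵥ hom e.1 = 1} = mass D g := fun g => hmap _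
  have hMpos : 0 < M := by omega
  have hM' : (0 : ℝ) < M := by exact_mod_cast hMpos
  have hA' : (0 : ℝ) < A := by exact_mod_cast hA
  have hb' : (0 : ℝ) < b := by exact_mod_cast hb
  set μ := Measure.pi fun _ : Fin M => ν with hμ
  -- The bad events: a wrong label (probability zero), an estimate off by `1 / (4 A)`, and a
  -- functional that vanishes on the whole sample (used for mass `1 / 2`).
  let B₁ : Fin M → Set (Fin M → Point d × Bool) := fun m => {S | f ⬝ᵥ hom (S m).1 ≠ bit (S m).2}
  let B₂ : Vec (d + 1) → Set (Fin M → Point d × Bool) := fun g =>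
    {S | 1 / (4 * A : ℝ) * M ≤
      |(∑ m, if S m ∈ {e : Point d × Bool | g ⬝ᵥ hom e.1 = 1} then (1 : ℝ) else 0) -
        M * ν.real {e | g ⬝ᵥ hom e.1 = 1}|}
  let B₃ : Vec (d + 1) → Set (Fin M → Point d × Bool) := fun g =>
    Set.univ.pi fun _ => {e | g ⬝ᵥ hom e.1 ≠ 1}
  have hB₁ : ∀ m, μ.real (B₁ m) = 0 := by
    intro m
    have h1 := (measurePreserving_eval (fun _ : Fin M => ν) m).measureReal_preimage
      (s := {e : Point d × Bool | f ⬝ᵥ hom e.1 ≠ bit e.2}) MeasurableSet.of_discrete.nullMeasurableSet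
    have h2 : ν.real {e : Point d × Bool | f ⬝ᵥ hom e.1 ≠ bit e.2} = 0 := by
      rw [hmap]; simp [hf]
    exact h1.trans h2
  have hB₂ : ∀ g, μ.real (B₂ g) ≤ 4 * A ^ 2 / M := by
    intro g
    refine (pi_real_deviation_le ν _ hMpos (by positivity)).trans (le_of_eq ?_)
    field_simp
  have hB₃ : ∀ g, mass D g = 1 / 2 → μ.real (B₃ g) = (1 / 2) ^ M := by
    intro g hg
    have h1 : ν.real {e | g ⬝ᵥ hom e.1 ≠ 1} = 1 / 2 := by
      have := probReal_compl_eq_one_sub (μ := ν) (s := {e | g ⬝ᵥ hom e.1 = 1})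
        MeasurableSet.of_discrete
      rw [hmass, hg] at this
      refine Eq.trans ?_ (this.trans (by norm_num))
      rfl
    rw [measureReal_def, hμ, Measure.pi_pi, ENNReal.toReal_prod]
    simp only [← measureReal_def, h1, Finset.prod_const, Finset.card_univ, Fintype.card_fin]
  have hsub : {S | ¬ Representative D ℓ A f (List.ofFn S)} ⊆
      (⋃ m ∈ (Finset.univ : Finset (Fin M)), B₁ m) ∪
      ((⋃ g ∈ (candidates (d + 1) (ℓ + 1)).toFinset, B₂ g) ∪
        ⋃ g ∈ Finset.univ.filter (fun g : Vec (d + 1) => mass D g = 1 / 2), B₃ g) := by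
    intro S hS
    by_contra hcon
    simp only [Set.mem_union, Set.mem_iUnion, not_or, not_exists] at hcon
    refine hS ⟨?_, ?_, ?_⟩
    · intro e he
      obtain ⟨m, rfl⟩ := (List.mem_ofFn' _ _).1 he
      exact not_not.1 (hcon.1 m (Finset.mem_univ m))
    · intro g hg
      have h1 := hcon.2.1 g (by simpa using hg)
      simp only [B₂, Set.mem_ofPred_eq, not_le] at h1
      rw [hmass] at h1
      rw [violations_ofFn, List.length_ofFn]
      have h2 := mul_le_mul_of_nonneg_right h1.le (by positivity : (0 : ℝ) ≤ 4 * A)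
      refine h2.trans (le_of_eq ?_)
      field_simp
    · intro g hg
      have h1 := hcon.2.2 g (by simpa using hg)
      simp only [B₃, Set.mem_univ_pi, not_forall, Set.mem_ofPred_eq, not_not] at h1
      obtain ⟨m, hm⟩ := h1
      exact ⟨S m, (List.mem_ofFn' _ _).2 ⟨m, rfl⟩, hm⟩
  have hc1 : ((candidates (d + 1) (ℓ + 1)).toFinset.card : ℝ) ≤ ((d + 2) ^ (ℓ + 1) : ℕ) := by
    exact_mod_cast (List.toFinset_card_le _).trans (length_candidates _ _).le
  have hc2 : ((Finset.univ.filter (fun g : Vec (d + 1) => mass D g = 1 / 2)).card : ℝ) ≤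
      2 ^ (d + 1) := by
    have : (Finset.univ.filter (fun g : Vec (d + 1) => mass D g = 1 / 2)).card ≤ 2 ^ (d + 1) := by
      refine (Finset.card_le_univ _).trans (le_of_eq ?_)
      simp [Vec]
    exact_mod_cast this
  have e1 : μ.real (⋃ m ∈ (Finset.univ : Finset (Fin M)), B₁ m) ≤ 0 :=
    (measureReal_biUnion_finset_le _ _).trans (by simp [hB₁])
  -- The failure probability `1 / b` is split evenly between the estimates and the covering of the
  -- functionals of mass `1 / 2`.
  have e2 : μ.real (⋃ g ∈ (candidates (d + 1) (ℓ + 1)).toFinset, B₂ g) ≤ 1 / (2 * b) := by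
    refine (measureReal_biUnion_finset_le _ _).trans
      ((Finset.sum_le_sum fun g _ => hB₂ g).trans ?_)
    rw [Finset.sum_const, nsmul_eq_mul]
    refine (mul_le_mul_of_nonneg_right hc1 (by positivity)).trans ?_
    rw [← mul_div_assoc, div_le_div_iff₀ hM' (by positivity), one_mul]
    have : ((8 * (d + 2) ^ (ℓ + 1) * A ^ 2 * b : ℕ) : ℝ) ≤ M := by exact_mod_cast hM₁
    push_cast at this ⊢
    linarith
  have e3 : μ.real (⋃ g ∈ Finset.univ.filter (fun g : Vec (d + 1) => mass D g = 1 / 2), B₃ g) ≤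
      1 / (2 * b) := by
    refine (measureReal_biUnion_finset_le _ _).trans
      ((Finset.sum_le_sum fun g hg => (hB₃ g (Finset.mem_filter.1 hg).2).le).trans ?_)
    rw [Finset.sum_const, nsmul_eq_mul]
    refine (mul_le_mul_of_nonneg_right hc2 (by positivity)).trans ?_
    rw [one_div, inv_pow, ← div_eq_mul_inv, div_le_div_iff₀ (by positivity) (by positivity),
      one_mul]
    have h1 : 2 * b ≤ 2 ^ (2 * b) := Nat.lt_two_pow_self.le
    have h2 : 2 ^ (d + 1) * (2 * b) ≤ 2 ^ M :=
      (Nat.mul_le_mul_left _ h1).trans ((pow_add 2 _ _).symm.le.trans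
        (Nat.pow_le_pow_right two_pos hM₂))
    exact_mod_cast h2
  refine (measureReal_mono hsub).trans ((measureReal_union_le _ _).trans
    ((add_le_add e1 ((measureReal_union_le _ _).trans (add_le_add e2 e3))).trans (le_of_eq ?_)))
  field_simp
  norm_num

/-! ### Affine parities as functionals -/

theorem encBit_injective : Function.Injective encBit := by
  intro a b h
  rcases zmod_two_cases a with rfl | rfl <;> rcases zmod_two_cases b with rfl | rfl <;>
    simp_all [encBit, Val.ofBool]

theorem ofList_injective : Function.Injective Val.ofList := by
  intro l₁
  induction l₁ with
  | nil => intro l₂ h; cases l₂ <;> simp_all [Val.ofList]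
  | cons a l₁ ih =>
    intro l₂ h
    cases l₂ with
    | nil => simp [Val.ofList] at h
    | cons b l₂ =>
      simp only [Val.ofList, Val.cons.injEq] at h
      rw [h.1, ih h.2]

theorem encVec_injective {n : ℕ} : Function.Injective (encVec (n := n)) := fun _ _ h =>
  funext fun i => encBit_injective (congrFun (List.ofFn_injective (ofList_injective h)) i)

theorem exists_functional {d : ℕ} {t : Point d → Bool} (ht : t ∈ AffParity d) :
    ∃ f : Vec (d + 1), ∀ x, f ⬝ᵥ hom x = bit (t x) := by
  obtain ⟨s, b, rfl⟩ := ht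
  refine ⟨Fin.cons (bit b) fun i => if i ∈ s then 1 else 0, fun x => ?_⟩
  have h1 : ∀ (b : Bool) (n : ℕ), bit (xor b (decide (Odd n))) = bit b + (n : ZMod 2) := by
    intro b n
    rcases Nat.even_or_odd n with h | h
    · rw [(ZMod.natCast_eq_zero_iff_even).2 h, decide_eq_false (Nat.not_odd_iff_even.2 h)]
      simp
    · rw [(ZMod.natCast_eq_one_iff_odd).2 h, decide_eq_true h]
      cases b <;> decide
  rw [affParity, h1, hom, dotProduct, Fin.sum_univ_succ]
  simp only [Fin.cons_zero, Fin.cons_succ, mul_one, ite_mul, one_mul, zero_mul]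
  rw [← Finset.sum_filter, Finset.card_filter, Nat.cast_sum]
  simp

/-- The hypothesis that an output stands for. -/
noncomputable def hypothesis {d : ℕ} (o : Val) (x : Point d) : Bool :=
  open Classical in decide (∃ u : Vec (d + 1), o = encVec u ∧ u ⬝ᵥ hom x = 1)

theorem hypothesis_encVec {d : ℕ} (u : Vec (d + 1)) (x : Point d) :
    hypothesis (encVec u) x = decide (u ⬝ᵥ hom x = 1) := by
  refine decide_eq_decide.2 ⟨?_, fun h => ⟨u, rfl, h⟩⟩
  rintro ⟨v, hv, h⟩
  rwa [encVec_injective hv]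

theorem hypothesis_ne_iff {d : ℕ} {t : Point d → Bool} {f : Vec (d + 1)}
    (hf : ∀ x, f ⬝ᵥ hom x = bit (t x)) (u : Vec (d + 1)) (x : Point d) :
    hypothesis (encVec u) x ≠ t x ↔ (u - f) ⬝ᵥ hom x = 1 := by
  rw [hypothesis_encVec, sub_dotProduct, hf]
  have : ∀ (a : ZMod 2) (b : Bool), decide (a = 1) ≠ b ↔ a - bit b = 1 := by
    intro a b
    rcases zmod_two_cases a with rfl | rfl <;> cases b <;> simp [bit]
  exact this _ _

/-! ### The sample size and the running time -/

/-- The number of true bits among those that the learner uses. -/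
def trueBits (d c : ℕ) {R : ℕ} (r : Fin R → Bool) : ℕ :=
  ((List.ofFn r).take (numBits d c)).count true

theorem trueBits_le (d c : ℕ) {R : ℕ} (r : Fin R → Bool) : trueBits d c r ≤ numBits d c :=
  List.count_le_length.trans (List.length_take_le _ _)

/-- The form `4 * k ^ 2`, with `k = 2 * ((d + 1) * c)`, needed for `coinLaw_count_le`. -/
theorem numBits_eq (d c : ℕ) : numBits d c = 4 * (2 * ((d + 1) * c)) ^ 2 := by
  unfold numBits; ring

theorem le_numBits {d c : ℕ} (hc : 0 < c) : 16 * (d + 1) ≤ numBits d c := by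
  have h1 : d + 1 ≤ ((d + 1) * c) * ((d + 1) * c) := by
    calc d + 1 = (d + 1) * 1 * (1 * 1) := by ring
      _ ≤ (d + 1) * c * ((d + 1) * c) :=
        Nat.mul_le_mul (Nat.mul_le_mul_left _ hc) (Nat.mul_le_mul (by omega) hc)
  calc 16 * (d + 1) ≤ 16 * (((d + 1) * c) * ((d + 1) * c)) := Nat.mul_le_mul_left _ h1
    _ = numBits d c := by unfold numBits; ring

theorem numBits_sq_le_scale {d a c : ℕ} (ha : 0 < a) :
    numBits d c * numBits d c ≤ scale d a c :=
  Nat.le_mul_of_pos_left _ ha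

/-- The base of the sample size. -/
def sizeBase (d a c b : ℕ) : ℕ := 8 * (d + 2) ^ 2 * scale d a c ^ 2 * b

/-- For `ℓ ≥ 1` the exponent `ℓ + 1` is at most `2 ℓ`, and the remaining positive factor only grows
under the power. -/
theorem le_sizeBase_pow {d ℓ a c b : ℕ} (hℓ : 1 ≤ ℓ) (ha : 0 < a) (hc : 0 < c) :
    8 * (d + 2) ^ (ℓ + 1) * scale d a c ^ 2 * b ≤ sizeBase d a c b ^ ℓ := by
  have h1 : 0 < scale d a c := by
    have := le_numBits (d := d) hc
    have := numBits_sq_le_scale (d := d) (c := c) ha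
    nlinarith
  have h2 : 8 * scale d a c ^ 2 * b ≤ (8 * scale d a c ^ 2 * b) ^ ℓ :=
    Nat.le_self_pow (by omega) _
  have h3 : (d + 2) ^ (ℓ + 1) ≤ ((d + 2) ^ 2) ^ ℓ := by
    rw [← pow_mul]
    exact Nat.pow_le_pow_right (by omega) (by omega)
  calc 8 * (d + 2) ^ (ℓ + 1) * scale d a c ^ 2 * b
      = (d + 2) ^ (ℓ + 1) * (8 * scale d a c ^ 2 * b) := by ring
    _ ≤ ((d + 2) ^ 2) ^ ℓ * (8 * scale d a c ^ 2 * b) ^ ℓ := Nat.mul_le_mul h3 h2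
    _ = sizeBase d a c b ^ ℓ := by rw [← mul_pow, sizeBase]; congr 1; ring

/-- An upper bound for the running times in terms of the sample size. -/
def timeBound (m : ℕ) : ℕ :=
  mulT m m + mulT 4 m + mulT m m + mulT m m + mulT m m + (m * 21 + 12) + thresholdT m m +
  flipsT m + (m * (m * (flipsT m + 30) + 60) + 20) + selectT m m (m * m) m m +
  (m * (elimT m m + 46) + 6) + (m * (elimT m m + 46) + 6) + 400 + (m * 80 + 140)

theorem exists_polynomial_timeBound : ∃ p : Polynomial ℕ, ∀ m, p.eval m = timeBound m := by
  open Polynomial in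
  let mul (u v : ℕ[X]) : ℕ[X] := u * (v * 21 + 50) + 20
  let fl : ℕ[X] := X * (X * 21 + 120) + 60
  let el : ℕ[X] := (X + 1) * (X * 400 + 500)
  refine ⟨mul X X + mul 4 X + mul X X + mul X X + mul X X + (X * 21 + 12) +
    (X * (X * 21 + 100) + 30) + fl + (X * (X * (fl + 30) + 60) + 20) +
    (X * ((X * (X * 80 + X * 21 + 250) + 30) + X * X * 21 + 60) + 20) +
    (X * (el + 46) + 6) + (X * (el + 46) + 6) + 400 + (X * 80 + 140), fun m => ?_⟩
  simp [mul, fl, el, timeBound, mulT, thresholdT, flipsT, selectT, violationsT, elimT]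

/-- All parameters, also `(d + 2) ^ (ℓ + 1)`, are at most `m`, and the bounds are monotone in each.
-/
theorem learnT_le_timeBound {d ℓ a c m i : ℕ} (hN : (d + 2) ^ (ℓ + 1) ≤ m) (hA : scale d a c ≤ m)
    (ha : 0 < a) (hc : 0 < c) (hi : i ≤ m) : learnT d ℓ a c m i ≤ timeBound m := by
  have h0 : d + 2 ≤ m := (Nat.le_self_pow (by omega) _).trans hN
  have hd : d ≤ m := by omega
  have hd1 : d + 1 ≤ m := by omega
  have hℓ : ℓ + 1 ≤ m := by
    have h1 : ℓ + 1 < 2 ^ (ℓ + 1) := Nat.lt_two_pow_self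
    have h2 : 2 ^ (ℓ + 1) ≤ (d + 2) ^ (ℓ + 1) := Nat.pow_le_pow_left (by omega) _
    omega
  have hB2 : numBits d c * numBits d c ≤ m := (numBits_sq_le_scale ha).trans hA
  have hBpos : 0 < numBits d c := by have := le_numBits (d := d) hc; omega
  have hB : numBits d c ≤ m := (Nat.le_mul_of_pos_left _ hBpos).trans hB2
  have ha' : a ≤ m := (Nat.le_mul_of_pos_right a (Nat.mul_pos hBpos hBpos)).trans hA
  have hk : 4 * ((d + 1) * c) ≤ m :=
    (Nat.le_mul_of_pos_left _ (by positivity)).trans hB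
  have hk' : (d + 1) * c ≤ m := by omega
  have hc' : c ≤ m := (Nat.le_mul_of_pos_left c (Nat.succ_pos d)).trans hk'
  have hN' : (d + 1 + 1) ^ (ℓ + 1) ≤ m := hN
  unfold learnT timeBound candidatesT
  refine le_trans ?_ (Nat.le_add_right _ _)
  unfold mulT thresholdT flipsT selectT violationsT elimT
  gcongr

/-! ### The learner is accurate and replicable -/

/-- This is why `scale` contains the square of `numBits`: one factor absorbs `i`, the other absorbs
`d + 1`, and `a` brings the rest below `α`. -/
theorem mul_level_le {d a c i : ℕ} {α : ℝ} (hα : 0 < α) (ha : 1 / α ≤ a) (hc : 0 < c)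
    (hi : i ≤ numBits d c) : (d + 1 : ℝ) * ((4 * i + 1) / (4 * scale d a c)) ≤ α := by
  have ha' : (0 : ℝ) < a := (one_div_pos.2 hα).trans_le ha
  have hB : (16 * (d + 1) : ℝ) ≤ numBits d c := by exact_mod_cast le_numBits (d := d) hc
  have hi' : (i : ℝ) ≤ numBits d c := by exact_mod_cast hi
  have hs : (scale d a c : ℝ) = a * (numBits d c * numBits d c) := by simp [scale]
  have hd : (0 : ℝ) ≤ d := Nat.cast_nonneg d
  have hBpos : (0 : ℝ) < numBits d c := by linarith
  have hαa : 1 ≤ α * a := by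
    rw [div_le_iff₀ hα] at ha; linarith
  rw [← mul_div_assoc, div_le_iff₀ (by rw [hs]; positivity), hs]
  calc (d + 1 : ℝ) * (4 * i + 1) ≤ (numBits d c / 16) * (5 * numBits d c) := by
        refine mul_le_mul (by linarith) (by linarith) (by positivity) (by positivity)
    _ ≤ 1 * (4 * (numBits d c * numBits d c)) := by nlinarith
    _ ≤ (α * a) * (4 * (numBits d c * numBits d c)) :=
        mul_le_mul_of_nonneg_right hαa (by positivity)
    _ = α * (4 * (a * (numBits d c * numBits d c))) := by ring

theorem isReplicablePACLearner_learnP {d ℓ a c b M K R T : ℕ} {α ρ β : ℝ}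
    {𝒟 : Set (Measure (Point d))} (h𝒟 : ∀ D ∈ 𝒟, dtComplexity D ≤ ℓ)
    (hα : 0 < α) (hρ : 0 < ρ) (hβ : 0 < β) (hβρ : β < ρ / 3)
    (ha : 1 / α ≤ a) (hc : 1 / ρ ≤ c) (hb : 1 / β ≤ b)
    (hM : 8 * (d + 2) ^ (ℓ + 1) * scale d a c ^ 2 * b ≤ M) (hR : M ≤ R) (hT : timeBound M ≤ T) :
    IsReplicablePACLearner learnP evalP (AffParity d) 𝒟 [d, ℓ, a, c, b] α ρ β M K R T := by
  have ha0 : 0 < a := by exact_mod_cast (one_div_pos.2 hα).trans_le ha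
  have hc0 : 0 < c := by exact_mod_cast (one_div_pos.2 hρ).trans_le hc
  have hb0 : 0 < b := by exact_mod_cast (one_div_pos.2 hβ).trans_le hb
  have hBpos : 0 < numBits d c := by have := le_numBits (d := d) hc0; omega
  have hA0 : 0 < scale d a c := (Nat.mul_pos hBpos hBpos).trans_le (numBits_sq_le_scale ha0)
  have hN0 : 0 < (d + 2) ^ (ℓ + 1) := by positivity
  have hNM : (d + 2) ^ (ℓ + 1) ≤ M := by
    refine le_trans ?_ hM
    calc (d + 2) ^ (ℓ + 1) = 1 * (d + 2) ^ (ℓ + 1) * 1 ^ 2 * 1 := by ring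
      _ ≤ _ := by gcongr <;> omega
  have hAM : scale d a c ≤ M := by
    refine le_trans ?_ hM
    calc scale d a c ≤ scale d a c ^ 2 := Nat.le_self_pow two_ne_zero _
      _ = 1 * 1 * scale d a c ^ 2 * 1 := by ring
      _ ≤ _ := by gcongr <;> omega
  have hbM : d + 1 + 2 * b ≤ M := by
    refine le_trans ?_ hM
    have h1 : d + 2 ≤ (d + 2) ^ (ℓ + 1) := Nat.le_self_pow (by omega) _
    calc d + 1 + 2 * b ≤ 8 * (d + 2) * 1 ^ 2 * b := by nlinarith
      _ ≤ _ := by gcongr; omega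
  have hBM : numBits d c ≤ M :=
    (Nat.le_mul_of_pos_left _ hBpos).trans ((numBits_sq_le_scale ha0).trans hAM)
  have hMpos : 0 < M := by omega
  refine ⟨fun z r => encVec (learn d ℓ a c (List.ofFn z.1) (trueBits d c r)), hypothesis,
    fun S w r => ?_, fun z r x => ?_, fun D hD hprob O hO t ht => ?_⟩
  · obtain ⟨s, hs, h⟩ := learnP_computes d ℓ a c b S r (hBM.trans hR)
    exact ⟨0, s, hs.trans ((learnT_le_timeBound hNM hAM ha0 hc0
      ((trueBits_le d c r).trans hBM)).trans hT), h _ 0⟩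
  · obtain ⟨s, hs, h⟩ := evalP_computes
      (learn d ℓ a c (List.ofFn z.1) (trueBits d c r)) x
    refine ⟨s, hs.trans (le_trans ?_ hT), ?_⟩
    · have : d * 80 + 140 ≤ M * 80 + 140 := by omega
      exact this.trans (Nat.le_add_left _ _)
    · rw [hypothesis_encVec]; exact h _ 0
  · obtain ⟨f, hf⟩ := exists_functional ht
    have hDℓ := h𝒟 D hD
    have hν : IsProbabilityMeasure (D.map fun x => (x, t x)) :=
      Measure.isProbabilityMeasure_map Measurable.of_discrete.aemeasurable
    have hOp := hO.prob
    set μ := Measure.pi fun _ : Fin M => D.map fun x => (x, t x) with hμ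
    set κ := Measure.pi fun _ : Fin K => Measure.pi fun c : Restriction d => O c with hκ
    have hlaw : dataLaw D O t M K = μ.prod κ := rfl
    rw [hlaw]
    let good : Set (Fin M → Point d × Bool) :=
      {S | Representative D ℓ (scale d a c) f (List.ofFn S)}
    have hbad : μ.real goodᶜ ≤ β := by
      refine (pi_real_not_representative_le hf hA0 hb0 hM hbM).trans ?_
      rw [div_le_iff₀ hβ] at hb
      rw [div_le_iff₀ (by exact_mod_cast hb0)]
      linarith
    have hlen : ∀ S : Fin M → Point d × Bool, 0 < (List.ofFn S).length := by simpa using hMpos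
    constructor
    · have h1 : ((μ.prod κ).prod (coinLaw R)).real
          ((fun z => z.1.1) ⁻¹' goodᶜ) ≤ β := by
        have hp := (measurePreserving_fst (μ := μ) (ν := κ)).comp
          (measurePreserving_fst (μ := μ.prod κ) (ν := coinLaw R))
        exact (hp.measureReal_preimage MeasurableSet.of_discrete.nullMeasurableSet).trans_le hbad
      have h2 := probReal_compl_eq_one_sub (μ := (μ.prod κ).prod (coinLaw R))
        (s := (fun z => z.1.1) ⁻¹' goodᶜ) MeasurableSet.of_discrete
      refine le_trans (by linarith) (h2.symm.trans_le (measureReal_mono ?_ (measure_ne_top _ _)))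
      intro z hz
      have hz' : Representative D ℓ (scale d a c) f (List.ofFn z.1.1) := not_not.1 hz
      rw [Set.mem_ofPred_eq]
      simp only [hypothesis_ne_iff hf]
      exact (mass_le_of_mem_level (by positivity) (hz'.span_le_level (hlen _) hA0 _
        (hz'.learn_sub_mem hDℓ _))).trans (mul_level_le hα ha hc0 (trueBits_le d c z.2))
    · classical
      -- The two ends of the window around the threshold `i`; a jump is a threshold whose window
      -- sees the span grow.
      let lo : ℕ → Submodule (ZMod 2) (Vec (d + 1)) := fun i =>
        level D ℓ ((4 * i - 1) / (4 * scale d a c))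
      let hi : ℕ → Submodule (ZMod 2) (Vec (d + 1)) := fun i =>
        level D ℓ ((4 * i + 1) / (4 * scale d a c))
      let jumps := (Finset.range (numBits d c + 1)).filter fun i => lo i ≠ hi i
      have hjumps : jumps.card ≤ d + 1 := by
        refine (card_jumps_le lo hi (fun i => level_mono D ℓ ?_) (fun i => level_mono D ℓ ?_)
          _).trans (by simp)
        · gcongr; linarith
        · push_cast; gcongr; linarith
      let E₁ : Set ((((Fin M → Point d × Bool) × (Fin K → Restriction d → Point d)) ×
        ((Fin M → Point d × Bool) × (Fin K → Restriction d → Point d))) × (Fin R → Bool)) :=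
        (fun z => z.1.1.1) ⁻¹' goodᶜ
      let E₂ : Set ((((Fin M → Point d × Bool) × (Fin K → Restriction d → Point d)) ×
        ((Fin M → Point d × Bool) × (Fin K → Restriction d → Point d))) × (Fin R → Bool)) :=
        (fun z => z.1.2.1) ⁻¹' goodᶜ
      let E₃ : Set ((((Fin M → Point d × Bool) × (Fin K → Restriction d → Point d)) ×
        ((Fin M → Point d × Bool) × (Fin K → Restriction d → Point d))) × (Fin R → Bool)) :=
        (fun z => z.2) ⁻¹' ⋃ i ∈ jumps, {r | trueBits d c r = i}
      set Ψ := ((μ.prod κ).prod (μ.prod κ)).prod (coinLaw R) with hΨ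
      have h1 : Ψ.real E₁ ≤ β := by
        have hp := ((measurePreserving_fst (μ := μ) (ν := κ)).comp
          (measurePreserving_fst (μ := μ.prod κ) (ν := μ.prod κ))).comp
          (measurePreserving_fst (μ := (μ.prod κ).prod (μ.prod κ)) (ν := coinLaw R))
        exact (hp.measureReal_preimage MeasurableSet.of_discrete.nullMeasurableSet).trans_le hbad
      have h2 : Ψ.real E₂ ≤ β := by
        have hp := ((measurePreserving_fst (μ := μ) (ν := κ)).comp
          (measurePreserving_snd (μ := μ.prod κ) (ν := μ.prod κ))).comp
          (measurePreserving_fst (μ := (μ.prod κ).prod (μ.prod κ)) (ν := coinLaw R))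
        exact (hp.measureReal_preimage MeasurableSet.of_discrete.nullMeasurableSet).trans_le hbad
      have h3 : Ψ.real E₃ ≤ ρ / 4 := by
        have hp := measurePreserving_snd (μ := (μ.prod κ).prod (μ.prod κ)) (ν := coinLaw R)
        refine (hp.measureReal_preimage MeasurableSet.of_discrete.nullMeasurableSet).trans_le ?_
        -- Each atom has probability at most `1 / (4 (d + 1) c)`; with at most `d + 1` jumps and `1
        -- / ρ ≤ c` this sums to at most `ρ / 4`.
        have hatom : ∀ i, (coinLaw R).real {r | trueBits d c r = i} ≤
            1 / (2 * (2 * ((d + 1) * c) : ℕ)) := by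
          intro i
          have := coinLaw_count_le (R := R) (k := 2 * ((d + 1) * c)) (by positivity)
            (by rw [← numBits_eq]; exact hBM.trans hR) i
          rwa [← numBits_eq] at this
        refine (measureReal_biUnion_finset_le _ _).trans
          ((Finset.sum_le_sum fun i _ => hatom i).trans ?_)
        rw [Finset.sum_const, nsmul_eq_mul]
        have hj : (jumps.card : ℝ) ≤ d + 1 := by exact_mod_cast hjumps
        refine (mul_le_mul_of_nonneg_right hj (by positivity)).trans ?_
        have hcr : 1 ≤ ρ * c := by
          rw [div_le_iff₀ hρ] at hc; linarith
        have hc' : (0 : ℝ) < c := by exact_mod_cast hc0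
        rw [mul_one_div, div_le_div_iff₀ (by positivity) (by norm_num)]
        push_cast
        nlinarith [mul_le_mul_of_nonneg_right hcr (by positivity : (0 : ℝ) ≤ 4 * (d + 1))]
      -- The total is `2 β + ρ / 4`, which is below `2 ρ / 3 + ρ / 4 < ρ`.
      refine (measureReal_mono (s₂ := E₁ ∪ (E₂ ∪ E₃)) ?_ (measure_ne_top _ _)).trans
        ((measureReal_union_le _ _).trans ((add_le_add h1 ((measureReal_union_le _ _).trans
          (add_le_add h2 h3))).trans (by linarith)))
      intro z hz
      by_contra hcon
      simp only [Set.mem_union, not_or] at hcon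
      obtain ⟨g1, g2, g3⟩ := hcon
      have r1 : Representative D ℓ (scale d a c) f (List.ofFn z.1.1.1) := not_not.1 g1
      have r2 : Representative D ℓ (scale d a c) f (List.ofFn z.1.2.1) := not_not.1 g2
      have heq : lo (trueBits d c z.2) = hi (trueBits d c z.2) := by
        by_contra hne
        refine g3 (Set.mem_iUnion₂.2 ⟨_, Finset.mem_filter.2 ⟨Finset.mem_range.2
          (Nat.lt_succ_of_le (trueBits_le d c z.2)), hne⟩, rfl⟩)
      -- Off the jumps the two ends of the window coincide and squeeze the span found from any
      -- representative sample.
      have hspan : ∀ S : List (Point d × Bool), Representative D ℓ (scale d a c) f S →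
          0 < S.length → listSpan (smallFunctionals d ℓ a c S (trueBits d c z.2)) =
            hi (trueBits d c z.2) := fun S hS hl =>
        le_antisymm (hS.span_le_level hl hA0 _) (heq ▸ hS.level_le_span hl hA0 _)
      refine hz (congrArg encVec ?_)
      rw [r1.learn_eq hDℓ, r2.learn_eq hDℓ]
      have hs : SameSpace (f, smallFunctionals d ℓ a c (List.ofFn z.1.1.1) (trueBits d c z.2))
          (f, smallFunctionals d ℓ a c (List.ofFn z.1.2.1) (trueBits d c z.2)) :=
        ⟨(hspan _ r1 (hlen _)).trans (hspan _ r2 (hlen _)).symm, by simp⟩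
      refine hs.elimAll_fst_eq fun u hu => ?_
      exact eq_zero_of_orthogonal_basisList fun v hv => hu _ (List.mem_map_of_mem hv)

theorem exists_sizeBase : ∃ q : MvPolynomial (Fin 4) ℕ, ∀ d a c b : ℕ,
    MvPolynomial.eval ![d, a, c, b] q = sizeBase d a c b := by
  open MvPolynomial in
  let k : MvPolynomial (Fin 4) ℕ := 4 * ((X 0 + 1) * X 2)
  refine ⟨8 * (X 0 + 2) ^ 2 * (X 1 * (k * k * (k * k))) ^ 2 * X 3, fun d a c b => ?_⟩
  simp [k, sizeBase, scale, numBits]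

end ReplicableParity

open ReplicableParity
theorem corollary4p2 :
    ∃ (q : MvPolynomial (Fin 4) ℕ) (c : ℕ) (pR pT : Polynomial ℕ),
      (∃ P E : Prog, ∀ (d ℓ : ℕ) (α ρ β : ℝ), 1 ≤ ℓ →
        0 < α → α < 1 → 0 < ρ → ρ < 1 → 0 < β → β < ρ / 3 →
        ∀ M : ℕ, M = sampleSize q c d ℓ α ρ β →
          IsReplicablePACLearner P E (AffParity d)
            {D | MonotoneDist D ∧ dtComplexity D ≤ ℓ}
            [d, ℓ, ⌈1 / α⌉₊, ⌈1 / ρ⌉₊, ⌈1 / β⌉₊] α ρ β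
            M 0 (pR.eval M) (pT.eval M)) ∧
      (∃ P E : Prog, ∀ (d ℓ : ℕ) (α ρ β : ℝ), 1 ≤ ℓ →
        0 < α → α < 1 → 0 < ρ → ρ < 1 → 0 < β → β < ρ / 3 →
        ∀ M : ℕ, M = sampleSize q c d ℓ α ρ β →
          IsReplicablePACLearner P E (AffParity d)
            {D | dtComplexity D ≤ ℓ}
            [d, ℓ, ⌈1 / α⌉₊, ⌈1 / ρ⌉₊, ⌈1 / β⌉₊] α ρ β
            M M (pR.eval M) (pT.eval M)) := by
  obtain ⟨q, hq⟩ := exists_sizeBase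
  obtain ⟨pT, hpT⟩ := exists_polynomial_timeBound
  have hsize : ∀ (d ℓ : ℕ) (α ρ β : ℝ), 1 ≤ ℓ → 0 < α → 0 < ρ →
      8 * (d + 2) ^ (ℓ + 1) * scale d ⌈1 / α⌉₊ ⌈1 / ρ⌉₊ ^ 2 * ⌈1 / β⌉₊ ≤
        sampleSize q 1 d ℓ α ρ β := by
    intro d ℓ α ρ β hℓ hα hρ
    rw [sampleSize, hq, one_mul]
    exact le_sizeBase_pow hℓ (Nat.ceil_pos.2 (one_div_pos.2 hα))
      (Nat.ceil_pos.2 (one_div_pos.2 hρ))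
  -- `M` coins are supplied, of which the learner reads the first `numBits`, at most `M` of them.
  refine ⟨q, 1, Polynomial.X, pT, ⟨learnP, evalP, ?_⟩, ⟨learnP, evalP, ?_⟩⟩
  · rintro d ℓ α ρ β hℓ hα - hρ - hβ hβρ M rfl
    exact isReplicablePACLearner_learnP (fun D hD => hD.2) hα hρ hβ hβρ (Nat.le_ceil _)
      (Nat.le_ceil _) (Nat.le_ceil _) (hsize d ℓ α ρ β hℓ hα hρ) (by simp) (hpT _).ge
  · rintro d ℓ α ρ β hℓ hα - hρ - hβ hβρ M rfl
    exact isReplicablePACLearner_learnP (fun D hD => hD) hα hρ hβ hβρ (Nat.le_ceil _)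
      (Nat.le_ceil _) (Nat.le_ceil _) (hsize d ℓ α ρ β hℓ hα hρ) (by simp) (hpT _).ge
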